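/- **Setting.** Let $\mathcal E$ be a finite set of facilities, $C_0\in\mathbb R$ the usage cost before an attack, $C_e\in\mathbb R$ the usage cost when $e\in\mathcal E$ is compromised, $c_a>0$ the cost of an attack and $c_d>0$ the cost of securing one facility. The defender chooses $s_d\subseteq\mathcal E$, the attacker chooses $s_a\in\mathcal E\cup\{\emptyset\}$ ($\emptyset$ means no attack). The usage cost is $C(s_d,s_a)=C_e$ if $s_a=e\notin s_d$ and $C(s_d,s_a)=C_0$ otherwise; the utilities are $u_d=-C(s_d,s_a)-c_d|s_d|$ and $u_a=C(s_d,s_a)-c_a\mathbf 1\{s_a\neq\emptyset\}$, and $U_d,U_a$ are their expectations under mixed strategies $\sigma_d\in\Delta(2^{\mathcal E})$, $\sigma_a\in\Delta(\mathcal E\cup\{\emptyset\})$. The effort vector of $\sigma_d$ is $\rho_e=\sum_{s_d\ni e}\sigma_d(s_d)$, $e\in\mathcal E$. In the sequential game the defender moves first and the attacker's strategy is a map $\tilde\sigma_a:\Delta(2^{\mathcal E})\to\Delta(\mathcal E\cup\{\emptyset\})$. Let $BR(\sigma_d)$ be the set of maximizers of $U_a(\sigma_d,\cdot)$. A pair $(\tilde\sigma_d^*,\tilde\sigma_a^*)$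 is a subgame perfect equilibrium (SPE) if $\tilde\sigma_a^*(\sigma_d)\in BR(\sigma_d)$ for every $\sigma_d$, and $U_d(\tilde\sigma_d^*,\tilde\sigma_a^*(\tilde\sigma_d^*))\ge U_d(\sigma_d,\tilde\sigma_a^*(\sigma_d))$ for every $\sigma_d$. Write $\tilde\rho^*$ for the effort vector of $\tilde\sigma_d^*$. Assume $\bar{\mathcal E}=\{e: C_e>C_0\}\ne\emptyset$. Let $C_{(1)}>\dots>C_{(K)}$ be the distinct values of $C_e$, $e\in\bar{\mathcal E}$, put $C_{(K+1)}:=C_0$, $\bar{\mathcal E}_{(k)}=\{e\in\bar{\mathcal E}: C_e=C_{(k)}\}$, $E_{(k)}=|\bar{\mathcal E}_{(k)}|$ and $S_i=\sum_{k=1}^{i}\frac{E_{(k)}}{C_{(k)}-C_0}$. For $1\le j\le i\le K$ let $$c_d^{ij}(x)=\frac{C_{(j)}-C_0}{(C_{(j)}-C_0)\,S_{j-1}+\sum_{k=j}^{i}E_{(k)}-x\,S_i}\qquad(S_0=0),$$ and for $0\le x<C_{(1)}-C_0$ let $\tilde c_d(x)=c_d^{ij}(x)$, where $1\le j\le i\le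 K$ is the unique pair with $C_{(i+1)}-C_0\le x<C_{(i)}-C_0$ and $\frac1{S_i}\sum_{k=j+1}^{i}E_{(k)}\le x<\frac1{S_i}\sum_{k=j}^{i}E_{(k)}$. Let $\tilde c_d^{-1}$ be the inverse function of $\tilde c_d$. The regimes are the following. - Type $\tilde{\mathrm I}$: regime $\tilde\Lambda_0$: $c_a>C_{(1)}-C_0$, $c_d>0$; regime $\tilde\Lambda_i$, $1\le i\le K$: $C_{(i+1)}-C_0<c_a<C_{(i)}-C_0$ and $0<c_d<\tilde c_d(c_a)$. - Type $\widetilde{\mathrm{II}}$: regime $\tilde\Lambda^j$, $1\le j\le K$: $0<c_a<\tilde c_d^{-1}(c_d)$, $c_d>S_j^{-1}$ and, if $j\ge2$, $c_d<S_{j-1}^{-1}$. **Theorem 2.** In each regime an SPE exists and the defender's effort vector $\tilde\rho^*$ is the same in all SPE. Moreover $(\tilde\sigma_d^*,\tilde\sigma_a^*)$ is an SPE if and only if: 1. in $\tilde\Lambda_0$: $\tilde\rho^*_e=0$ for all $e\in\mathcal E$, and $\tilde\sigma_a^*(\sigma_d)$ is "no attack" with probability $1$ for every $\sigma_d$; 2.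 in $\tilde\Lambda_i$, $1\le i\le K$: $\tilde\rho^*_e=\frac{C_{(k)}-c_a-C_0}{C_{(k)}-C_0}$ for $e\in\bar{\mathcal E}_{(k)}$, $k=1,\dots,i$, and $\tilde\rho^*_e=0$ for all other $e$; $\tilde\sigma_a^*(\tilde\sigma_d^*)$ is "no attack" with probability $1$; and $\tilde\sigma_a^*(\sigma_d)\in BR(\sigma_d)$ for all $\sigma_d\ne\tilde\sigma_d^*$; 3. in $\tilde\Lambda^1$: $\tilde\rho^*_e=0$ for all $e\in\mathcal E$; $\tilde\sigma_a^*(\tilde\sigma_d^*)\in\Delta(\bar{\mathcal E}_{(1)})$; and $\tilde\sigma_a^*(\sigma_d)\in BR(\sigma_d)$ for all $\sigma_d\ne\tilde\sigma_d^*$; 4. in $\tilde\Lambda^j$, $2\le j\le K$: $\tilde\rho^*_e=\frac{C_{(k)}-C_{(j)}}{C_{(k)}-C_0}$ for $e\in\bar{\mathcal E}_{(k)}$, $k=1,\dots,j-1$, and $\tilde\rho^*_e=0$ for all other $e$; $\tilde\sigma_a^*(\tilde\sigma_d^*)\in\Delta\big(\bigcup_{k=1}^{j}\bar{\mathcal E}_{(k)}\big)$;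 and $\tilde\sigma_a^*(\sigma_d)\in BR(\sigma_d)$ for all $\sigma_d\ne\tilde\sigma_d^*$. In 3 and 4 the total attack probability is thus $1$; moreover, in the type $\widetilde{\mathrm{II}}$ regimes the set of effort vectors of the defender in SPE coincides with the set of effort vectors of the defender in Nash equilibria of the simultaneous-move game with the same utilities. -/

import Mathlib

/-!
Attacker-defender security game on a finite set `E` of facilities.
Parameters: `C0` is the usage cost before an attack, `C e` the usage cost if `e` is compromised,
`ca` the cost of an attack and `cd` the cost of securing one facility.
-/

namespace SecurityGame

noncomputable section

/-! ### The game -/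

/-- Mixed strategies of the defender: probability distributions over the subsets of `E`. -/
abbrev DefStrategy (E : Type*) [Fintype E] : Type _ := ↥(stdSimplex ℝ (Finset E))

/-- Mixed strategies of the attacker: probability distributions over `E ∪ {∅}`; the action
`none` is "no attack" and `some e` is "target `e`". -/
abbrev AttStrategy (E : Type*) [Fintype E] : Type _ := ↥(stdSimplex ℝ (Option E))

/-- Usage cost after the interaction, for a pure strategy profile. -/
def usageCost {E : Type*} [DecidableEq E] (C0 : ℝ) (C : E → ℝ) (S : Finset E) :
    Option E → ℝ
  | none => C0
  | some e => if e ∈ S then C0 else C e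

/-- Defender's utility of a pure strategy profile. -/
def pureUd {E : Type*} [DecidableEq E] (C0 : ℝ) (C : E → ℝ) (cd : ℝ) (S : Finset E)
    (a : Option E) : ℝ :=
  -usageCost C0 C S a - cd * (S.card : ℝ)

/-- Attacker's utility of a pure strategy profile. -/
def pureUa {E : Type*} [DecidableEq E] (C0 : ℝ) (C : E → ℝ) (ca : ℝ) (S : Finset E)
    (a : Option E) : ℝ :=
  usageCost C0 C S a - ca * (if a = none then 0 else 1)

/-- Defender's expected utility of a mixed strategy profile. -/
def Ud {E : Type*} [Fintype E] [DecidableEq E] (C0 : ℝ) (C : E → ℝ) (cd : ℝ)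
    (σd : DefStrategy E) (σa : AttStrategy E) : ℝ :=
  ∑ S : Finset E, ∑ a : Option E, pureUd C0 C cd S a * σa.1 a * σd.1 S

/-- Attacker's expected utility of a mixed strategy profile. -/
def Ua {E : Type*} [Fintype E] [DecidableEq E] (C0 : ℝ) (C : E → ℝ) (ca : ℝ)
    (σd : DefStrategy E) (σa : AttStrategy E) : ℝ :=
  ∑ S : Finset E, ∑ a : Option E, pureUa C0 C ca S a * σa.1 a * σd.1 S

/-- Security effort vector of a defender's mixed strategy: `effort σd e` is the probability
that facility `e` is secured. -/
def effort {E : Type*} [Fintype E] [DecidableEq E] (σd : DefStrategy E) (e : E) : ℝ :=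
  ∑ S : Finset E with e ∈ S, σd.1 S

/-- The attacker's best responses to a strategy of the defender. -/
def BR {E : Type*} [Fintype E] [DecidableEq E] (C0 : ℝ) (C : E → ℝ) (ca : ℝ)
    (σd : DefStrategy E) : Set (AttStrategy E) :=
  {τ | ∀ τ' : AttStrategy E, Ua C0 C ca σd τ' ≤ Ua C0 C ca σd τ}

/-- Nash equilibria of the simultaneous-move game. -/
def IsNE {E : Type*} [Fintype E] [DecidableEq E] (C0 : ℝ) (C : E → ℝ) (ca cd : ℝ)
    (σd : DefStrategy E) (σa : AttStrategy E) : Prop :=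
  (∀ σd' : DefStrategy E, Ud C0 C cd σd' σa ≤ Ud C0 C cd σd σa) ∧
  (∀ σa' : AttStrategy E, Ua C0 C ca σd σa' ≤ Ua C0 C ca σd σa)

/-- Subgame perfect equilibria of the sequential game, in which the defender moves first and a
strategy of the attacker is a map from the strategies of the defender to `AttStrategy E`. -/
def IsSPE {E : Type*} [Fintype E] [DecidableEq E] (C0 : ℝ) (C : E → ℝ) (ca cd : ℝ)
    (σd : DefStrategy E) (σa : DefStrategy E → AttStrategy E) : Prop :=
  (∀ σd' : DefStrategy E, Ud C0 C cd σd' (σa σd') ≤ Ud C0 C cd σd (σa σd)) ∧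
  (∀ (σd' : DefStrategy E) (τ : AttStrategy E),
    Ua C0 C ca σd' τ ≤ Ua C0 C ca σd' (σa σd'))

/-- The set of the defender's security effort vectors in Nash equilibria. -/
def neEfforts {E : Type*} [Fintype E] [DecidableEq E] (C0 : ℝ) (C : E → ℝ) (ca cd : ℝ) :
    Set (E → ℝ) :=
  {ρ | ∃ (σd : DefStrategy E) (σa : AttStrategy E), IsNE C0 C ca cd σd σa ∧ effort σd = ρ}

/-- The set of the defender's security effort vectors in subgame perfect equilibria. -/
def speEfforts {E : Type*} [Fintype E] [DecidableEq E] (C0 : ℝ) (C : E → ℝ) (ca cd : ℝ) :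
    Set (E → ℝ) :=
  {ρ | ∃ (σd : DefStrategy E) (σa : DefStrategy E → AttStrategy E),
    IsSPE C0 C ca cd σd σa ∧ effort σd = ρ}

/-- `τ ∈ Δ(A)`: the attacker targets a facility of `A` with probability one. -/
def AttacksWithin {E : Type*} [Fintype E] (τ : AttStrategy E) (A : Finset E) : Prop :=
  τ.1 none = 0 ∧ ∀ e, e ∉ A → τ.1 (some e) = 0

/-! ### Ordering of the facilities by usage cost -/

/-- The facilities whose damage increases the usage cost. -/
def Ebar {E : Type*} [Fintype E] (C0 : ℝ) (C : E → ℝ) : Finset E :=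
  {e : E | C0 < C e}

/-- The set of distinct values of `C` on `Ebar`. -/
def costValues {E : Type*} [Fintype E] (C0 : ℝ) (C : E → ℝ) : Finset ℝ :=
  (Ebar C0 C).image C

/-- The number `K` of distinct values of `C` on `Ebar`. -/
def numValues {E : Type*} [Fintype E] (C0 : ℝ) (C : E → ℝ) : ℕ :=
  (costValues C0 C).card

/-- `C_(k)`, the `k`-th highest distinct value of `C` on `Ebar`, for `k = 1, …, K`, with the
convention `C_(K+1) = C0` (the value at `k = 0` is never used). -/
def ordCost {E : Type*} [Fintype E] (C0 : ℝ) (C : E → ℝ) (k : ℕ) : ℝ :=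
  ((costValues C0 C).sort (· ≥ ·)).getD (k - 1) C0

/-- The group of facilities in `Ebar` with usage cost `C_(k)`. -/
def group {E : Type*} [Fintype E] (C0 : ℝ) (C : E → ℝ) (k : ℕ) : Finset E :=
  {e ∈ Ebar C0 C | C e = ordCost C0 C k}

/-- `E_(k)`, the number of facilities in the `k`-th group. -/
def groupCard {E : Type*} [Fintype E] (C0 : ℝ) (C : E → ℝ) (k : ℕ) : ℝ :=
  ((group C0 C k).card : ℝ)

/-- The facilities in the groups `1, …, i`. -/
def topGroups {E : Type*} [Fintype E] [DecidableEq E] (C0 : ℝ) (C : E → ℝ) (i : ℕ) :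
    Finset E :=
  (Finset.Icc 1 i).biUnion (group C0 C)

/-- `∑_{k=1}^{i} E_(k) / (C_(k) - C0)`. -/
def invSum {E : Type*} [Fintype E] (C0 : ℝ) (C : E → ℝ) (i : ℕ) : ℝ :=
  ∑ k ∈ Finset.Icc 1 i, groupCard C0 C k / (ordCost C0 C k - C0)

/-! ### The threshold defense cost and the regimes -/

/-- The functions `c_d^{ij}` of the attack cost `x`, for `1 ≤ j ≤ i ≤ K`. -/
def cdij {E : Type*} [Fintype E] (C0 : ℝ) (C : E → ℝ) (i j : ℕ) (x : ℝ) : ℝ :=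
  if j = 1 then
    (ordCost C0 C 1 - C0) /
      (∑ k ∈ Finset.Icc 1 i, groupCard C0 C k
        - ∑ k ∈ Finset.Icc 1 i, x * groupCard C0 C k / (ordCost C0 C k - C0))
  else
    (ordCost C0 C j - C0) /
      ((ordCost C0 C j - C0)
          * (∑ k ∈ Finset.Icc 1 (j - 1), groupCard C0 C k / (ordCost C0 C k - C0))
        + ∑ k ∈ Finset.Icc j i, groupCard C0 C k
        - ∑ k ∈ Finset.Icc 1 i, x * groupCard C0 C k / (ordCost C0 C k - C0))

/-- The piece of the attack-cost axis, indexed by `1 ≤ j ≤ i ≤ K`, on which the threshold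
defense cost is given by `c_d^{ij}`. -/
def InPiece {E : Type*} [Fintype E] (C0 : ℝ) (C : E → ℝ) (i j : ℕ) (x : ℝ) : Prop :=
  (ordCost C0 C (i + 1) - C0 ≤ x ∧ x < ordCost C0 C i - C0) ∧
  ((∑ k ∈ Finset.Icc (j + 1) i, groupCard C0 C k) / invSum C0 C i ≤ x ∧
    x < (∑ k ∈ Finset.Icc j i, groupCard C0 C k) / invSum C0 C i)

open Classical in
/-- The threshold defense cost as a function of the attack cost `x`, `0 ≤ x < C_(1) - C0`: it
is `c_d^{ij}(x)` for the only pair `1 ≤ j ≤ i ≤ K` such that `x` is in the piece of `(i, j)`. -/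
def cdTilde {E : Type*} [Fintype E] (C0 : ℝ) (C : E → ℝ) (x : ℝ) : ℝ :=
  ∑ i ∈ Finset.Icc 1 (numValues C0 C), ∑ j ∈ Finset.Icc 1 i,
    if InPiece C0 C i j x then cdij C0 C i j x else 0

/-- The inverse of the threshold `cdTilde`, which is a function on `[0, C_(1) - C0)`. -/
def cdTildeInv {E : Type*} [Fintype E] (C0 : ℝ) (C : E → ℝ) (y : ℝ) : ℝ :=
  Function.invFunOn (cdTilde C0 C) (Set.Ico 0 (ordCost C0 C 1 - C0)) y

/-- The regime `i = 0` of the first type. -/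
def RegimeOneZero {E : Type*} [Fintype E] (C0 : ℝ) (C : E → ℝ) (ca cd : ℝ) : Prop :=
  ordCost C0 C 1 - C0 < ca ∧ 0 < cd

/-- The regimes `i = 1, …, K` of the first type (for `i = K` the lower bound on `ca` is `0`). -/
def RegimeOne {E : Type*} [Fintype E] (C0 : ℝ) (C : E → ℝ) (i : ℕ) (ca cd : ℝ) : Prop :=
  (ordCost C0 C (i + 1) - C0 < ca ∧ ca < ordCost C0 C i - C0) ∧
  (0 < cd ∧ cd < cdTilde C0 C ca)

/-- The regimes `j = 1, …, K` of the second type. -/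
def RegimeTwo {E : Type*} [Fintype E] (C0 : ℝ) (C : E → ℝ) (j : ℕ) (ca cd : ℝ) : Prop :=
  (0 < ca ∧ ca < cdTildeInv C0 C cd) ∧
  ((invSum C0 C j)⁻¹ < cd ∧ (2 ≤ j → cd < (invSum C0 C (j - 1))⁻¹))

end

end SecurityGame

/-!
Both players care about a defense only through its effort vector `ρ`, and the attacker's best
replies are governed by the largest threat `max_e (1 - ρ e) * (C e - C0)`. Lowering it to `t` costs
at least `cd * N t`, where the least total effort `N` (`minTotal`) is convex and piecewise linear,
with kinks at the damages `C e - C0`. A defender who moves first therefore either deters the attack,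
at the infimal cost `cd * N ca`, or tolerates it at a level `t > ca`, at the cost `t + cd * N t`.

The second cost is minimal at `C_(j) - C0` when `cd` lies between the reciprocals of the one-sided
slopes `invSum (j - 1)` and `invSum j`, and the threshold `cdTilde ca` is the defense cost at which
the two options are equally good. Efforts that deter exactly at `ca` leave the attacker indifferent,
but slightly higher ones force him to give up, so in equilibrium he does not attack. In the
tolerance regimes mixed attacks that make the defender indifferent about her efforts show that the
same efforts are those of the Nash equilibria.
-/

namespace SecurityGame

section Game

variable {E : Type*} [Fintype E]

/-- The damages `C_e - C_0` of the facilities. -/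
def damage (C0 : ℝ) (C : E → ℝ) (e : E) : ℝ :=
  C e - C0

/-- The expected increase of the usage cost when the defender exerts the efforts `ρ` and the
attacker plays `τ`, for the damages `δ`. -/
def expectedLoss (δ ρ : E → ℝ) (τ : AttStrategy E) : ℝ :=
  ∑ e, τ.1 (some e) * ((1 - ρ e) * δ e)

/-- The quantity that the defender minimizes: expected loss plus cost of the efforts. -/
def defenderCost (δ : E → ℝ) (cd : ℝ) (ρ : E → ℝ) (τ : AttStrategy E) : ℝ :=
  expectedLoss δ ρ τ + cd * ∑ e, ρ e

lemma AttStrategy.sum_some (τ : AttStrategy E) : ∑ e, τ.1 (some e) = 1 - τ.1 none := by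
  rw [← τ.2.2, Fintype.sum_option, add_sub_cancel_left]

lemma expectedLoss_le {δ ρ : E → ℝ} {t : ℝ} (h : ∀ e, (1 - ρ e) * δ e ≤ t) (τ : AttStrategy E) :
    expectedLoss δ ρ τ ≤ t * (1 - τ.1 none) := by
  rw [← τ.sum_some, mul_comm, Finset.sum_mul]
  exact Finset.sum_le_sum fun e _ => mul_le_mul_of_nonneg_left (h e) (τ.2.1 _)

lemma expectedLoss_eq_zero (δ ρ : E → ℝ) {τ : AttStrategy E} (h : τ.1 none = 1) :
    expectedLoss δ ρ τ = 0 := by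
  have hsum : ∑ e, τ.1 (some e) = 0 := by rw [τ.sum_some, h, sub_self]
  rw [Finset.sum_eq_zero_iff_of_nonneg fun e _ => τ.2.1 _] at hsum
  exact Finset.sum_eq_zero fun e he => by rw [hsum e he, zero_mul]

lemma defenderCost_eq_of_none_eq_one {δ ρ : E → ℝ} {cd : ℝ} {τ : AttStrategy E}
    (hτ : τ.1 none = 1) :
    defenderCost δ cd ρ τ = cd * ∑ e, ρ e := by
  rw [defenderCost, expectedLoss_eq_zero _ _ hτ, zero_add]

variable [DecidableEq E]

lemma effort_eq_sum_ite (σ : DefStrategy E) (e : E) :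
    effort σ e = ∑ S : Finset E, if e ∈ S then σ.1 S else 0 :=
  Finset.sum_filter _ _

lemma effort_nonneg (σ : DefStrategy E) (e : E) : 0 ≤ effort σ e :=
  Finset.sum_nonneg fun S _ => σ.2.1 S

lemma effort_le_one (σ : DefStrategy E) (e : E) : effort σ e ≤ 1 := by
  rw [← σ.2.2]
  exact Finset.sum_le_sum_of_subset_of_nonneg (Finset.filter_subset _ _) fun S _ _ => σ.2.1 S

lemma sum_card_mul_eq_sum_effort (σ : DefStrategy E) :
    ∑ S : Finset E, (S.card : ℝ) * σ.1 S = ∑ e, effort σ e := by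
  simp_rw [effort_eq_sum_ite]
  rw [Finset.sum_comm]
  exact Finset.sum_congr rfl fun S _ => by simp

/-- The defender's strategy that secures each facility `e` independently with probability
`ρ e`. It shows that every vector of the unit cube is an effort vector. -/
def independentDefense (ρ : E → ℝ) (h0 : ∀ e, 0 ≤ ρ e) (h1 : ∀ e, ρ e ≤ 1) : DefStrategy E :=
  ⟨fun S => (∏ e ∈ S, ρ e) * ∏ e ∈ Sᶜ, (1 - ρ e),
    fun _ => mul_nonneg (Finset.prod_nonneg fun e _ => h0 e)
      (Finset.prod_nonneg fun e _ => sub_nonneg.2 (h1 e)),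
    by simp [← Fintype.prod_add]⟩

lemma effort_independentDefense {ρ : E → ℝ} (h0 : ∀ e, 0 ≤ ρ e) (h1 : ∀ e, ρ e ≤ 1) :
    effort (independentDefense ρ h0 h1) = ρ := by
  funext e
  have restrict (S : Finset E) : (if e ∈ S then (independentDefense ρ h0 h1).1 S else 0)
      = (∏ x ∈ S, ρ x) * ∏ x ∈ Sᶜ, if x = e then 0 else 1 - ρ x := by
    split_ifs with he
    · refine congrArg _ (Finset.prod_congr rfl fun x hx => (if_neg ?_).symm)
      rintro rfl
      exact Finset.mem_compl.1 hx he
    · have hzero : ∏ x ∈ Sᶜ, (if x = e then 0 else 1 - ρ x) = 0 :=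
        Finset.prod_eq_zero (Finset.mem_compl.2 he) (if_pos rfl)
      rw [hzero, mul_zero]
  calc effort (independentDefense ρ h0 h1) e
      = ∑ S, (∏ x ∈ S, ρ x) * ∏ x ∈ Sᶜ, (if x = e then 0 else 1 - ρ x) := by
        rw [effort_eq_sum_ite, Finset.sum_congr rfl fun S _ => restrict S]
    _ = ∏ x, (ρ x + if x = e then 0 else 1 - ρ x) := (Fintype.prod_add _ _).symm
    _ = ρ e := by
        rw [Fintype.prod_eq_single e fun x hx => by simp [hx]]
        simp

lemma sum_usageCost_some (C0 : ℝ) (C : E → ℝ) (σ : DefStrategy E) (e : E) :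
    ∑ S : Finset E, usageCost C0 C S (some e) * σ.1 S
      = C0 + (1 - effort σ e) * damage C0 C e := by
  have h (S : Finset E) : usageCost C0 C S (some e) * σ.1 S
      = C e * σ.1 S - damage C0 C e * (if e ∈ S then σ.1 S else 0) := by
    simp only [usageCost, damage]
    split_ifs <;> ring
  rw [Finset.sum_congr rfl fun S _ => h S, Finset.sum_sub_distrib, ← Finset.mul_sum,
    ← Finset.mul_sum, ← effort_eq_sum_ite, σ.2.2, damage]
  ring

lemma sum_sum_usageCost (C0 : ℝ) (C : E → ℝ) (σ : DefStrategy E) (τ : AttStrategy E) :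
    ∑ S : Finset E, ∑ a : Option E, usageCost C0 C S a * τ.1 a * σ.1 S
      = C0 + expectedLoss (damage C0 C) (effort σ) τ := by
  have factor (a : Option E) : ∑ S : Finset E, usageCost C0 C S a * τ.1 a * σ.1 S
      = τ.1 a * ∑ S : Finset E, usageCost C0 C S a * σ.1 S := by
    rw [Finset.mul_sum]
    exact Finset.sum_congr rfl fun S _ => by ring
  rw [Finset.sum_comm, Finset.sum_congr rfl fun a _ => factor a, Fintype.sum_option]
  simp only [sum_usageCost_some]
  simp only [usageCost, ← Finset.mul_sum, σ.2.2, mul_add, Finset.sum_add_distrib,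
    ← Finset.sum_mul, τ.sum_some, expectedLoss]
  ring

lemma Ud_eq (C0 : ℝ) (C : E → ℝ) (cd : ℝ) (σ : DefStrategy E) (τ : AttStrategy E) :
    Ud C0 C cd σ τ = -C0 - defenderCost (damage C0 C) cd (effort σ) τ := by
  have h (S : Finset E) : ∑ a : Option E, pureUd C0 C cd S a * τ.1 a * σ.1 S
      = -(∑ a : Option E, usageCost C0 C S a * τ.1 a * σ.1 S)
        - cd * ((S.card : ℝ) * σ.1 S) := by
    have hcard : cd * ((S.card : ℝ) * σ.1 S)
        = ∑ a : Option E, τ.1 a * (cd * ((S.card : ℝ) * σ.1 S)) := by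
      rw [← Finset.sum_mul, τ.2.2, one_mul]
    rw [hcard, ← Finset.sum_neg_distrib, ← Finset.sum_sub_distrib]
    exact Finset.sum_congr rfl fun a _ => by rw [pureUd]; ring
  rw [Ud, Finset.sum_congr rfl fun S _ => h S, Finset.sum_sub_distrib, Finset.sum_neg_distrib,
    sum_sum_usageCost, ← Finset.mul_sum, sum_card_mul_eq_sum_effort, defenderCost]
  ring

lemma Ua_eq (C0 : ℝ) (C : E → ℝ) (ca : ℝ) (σ : DefStrategy E) (τ : AttStrategy E) :
    Ua C0 C ca σ τ
      = C0 + expectedLoss (damage C0 C) (effort σ) τ - ca * (1 - τ.1 none) := by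
  have h (S : Finset E) : ∑ a : Option E, pureUa C0 C ca S a * τ.1 a * σ.1 S
      = (∑ a : Option E, usageCost C0 C S a * τ.1 a * σ.1 S)
        - ca * (1 - τ.1 none) * σ.1 S := by
    have hattack : ca * (1 - τ.1 none) * σ.1 S
        = ∑ a : Option E, ca * (if a = none then 0 else 1) * τ.1 a * σ.1 S := by
      simp [Fintype.sum_option, ← τ.sum_some, Finset.mul_sum, Finset.sum_mul]
    rw [hattack, ← Finset.sum_sub_distrib]
    exact Finset.sum_congr rfl fun a _ => by rw [pureUa]; ring
  rw [Ua, Finset.sum_congr rfl fun S _ => h S, Finset.sum_sub_distrib,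
    sum_sum_usageCost, ← Finset.mul_sum, σ.2.2]
  ring

lemma BR_nonempty (C0 : ℝ) (C : E → ℝ) (ca : ℝ) (σ : DefStrategy E) :
    (BR C0 C ca σ).Nonempty := by
  have hcoord (a : Option E) : Continuous fun τ : AttStrategy E => τ.1 a :=
    (continuous_apply a).comp continuous_subtype_val
  have hcont : Continuous (Ua C0 C ca σ) :=
    continuous_finsetSum _ fun S _ => continuous_finsetSum _ fun a _ =>
      ((hcoord a).const_mul _).mul_const _
  obtain ⟨τ, -, hτ⟩ := isCompact_univ.exists_isMaxOn Set.univ_nonempty hcont.continuousOn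
  exact ⟨τ, fun τ' => hτ (Set.mem_univ τ')⟩

/-- With `t - ca` the attacker's optimal gain over not attacking, optimality means that `t` bounds
the threats `(1 - ρ e) * δ e` and that the attacker never forgoes a positive gain. -/
lemma mem_BR_iff {C0 : ℝ} {C : E → ℝ} {ca : ℝ} {σ : DefStrategy E} {τ : AttStrategy E} :
    τ ∈ BR C0 C ca σ ↔ ∃ t ≥ ca, (∀ e, (1 - effort σ e) * damage C0 C e ≤ t) ∧
      expectedLoss (damage C0 C) (effort σ) τ = t * (1 - τ.1 none) ∧
      (ca < t → τ.1 none = 0) := by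
  constructor
  · intro h
    set L := expectedLoss (damage C0 C) (effort σ) τ with hL
    have hgain (τ' : AttStrategy E) : expectedLoss (damage C0 C) (effort σ) τ'
        - ca * (1 - τ'.1 none) ≤ L - ca * (1 - τ.1 none) := by
      have hτ' := h τ'
      rw [Ua_eq, Ua_eq, ← hL] at hτ'
      linarith
    have hca : ca ≤ ca + (L - ca * (1 - τ.1 none)) := by
      simpa [expectedLoss] using hgain (stdSimplex.vertex none)
    have hthreat (e : E) : (1 - effort σ e) * damage C0 C e
        ≤ ca + (L - ca * (1 - τ.1 none)) := by
      have := hgain (stdSimplex.vertex (some e))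
      simp [expectedLoss, Pi.single_apply] at this
      linarith
    have hforgone : (L - ca * (1 - τ.1 none)) * τ.1 none = 0 :=
      le_antisymm (by linarith [expectedLoss_le hthreat τ])
        (mul_nonneg (by linarith) (τ.2.1 none))
    refine ⟨_, hca, hthreat, by linarith, fun hlt => ?_⟩
    exact (mul_eq_zero.1 hforgone).resolve_left (by linarith)
  · rintro ⟨t, hca, hthreat, hloss, hnone⟩ τ'
    have hforgone : (t - ca) * τ.1 none = 0 := by
      rcases hca.eq_or_lt with rfl | hlt
      · rw [sub_self, zero_mul]
      · rw [hnone hlt, mul_zero]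
    have hforgone' : 0 ≤ (t - ca) * τ'.1 none := mul_nonneg (sub_nonneg.2 hca) (τ'.2.1 none)
    rw [Ua_eq, Ua_eq, hloss]
    linarith [expectedLoss_le hthreat τ']

lemma mem_BR_of_none_eq_one {C0 : ℝ} {C : E → ℝ} {ca : ℝ} {σ : DefStrategy E}
    (hσ : ∀ e, (1 - effort σ e) * damage C0 C e ≤ ca) {τ : AttStrategy E} (hτ : τ.1 none = 1) :
    τ ∈ BR C0 C ca σ :=
  mem_BR_iff.2 ⟨ca, le_rfl, hσ, by rw [expectedLoss_eq_zero _ _ hτ, hτ, sub_self, mul_zero],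
    fun h => absurd h (lt_irrefl _)⟩

lemma mem_BR_iff_none_eq_one {C0 : ℝ} {C : E → ℝ} {ca s : ℝ} {σ : DefStrategy E} (hs : s < ca)
    (hσ : ∀ e, (1 - effort σ e) * damage C0 C e ≤ s) {τ : AttStrategy E} :
    τ ∈ BR C0 C ca σ ↔ τ.1 none = 1 := by
  refine ⟨fun hτ => ?_, mem_BR_of_none_eq_one fun e => (hσ e).trans hs.le⟩
  obtain ⟨t, hca, -, hloss, -⟩ := mem_BR_iff.1 hτ
  have hattack : (t - s) * (1 - τ.1 none) ≤ 0 := by linarith [expectedLoss_le hσ τ]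
  refine (stdSimplex.le_one τ none).antisymm (sub_nonpos.1 ?_)
  exact nonpos_of_mul_nonpos_right hattack (by linarith)

end Game

section MinEffort

variable {E : Type*} {δ ρ : E → ℝ} {s t : ℝ} {e : E}

/-- The least effort on `e` that brings the expected damage `(1 - ρ e) * δ e` of an attack on `e`
down to the level `t ≥ 0`. The numerator is `0` whenever `δ e ≤ 0`, so the junk value of the
division is the intended one. -/
noncomputable def minEffort (δ : E → ℝ) (t : ℝ) (e : E) : ℝ :=
  max 0 (δ e - t) / δ e

lemma minEffort_of_le (h : δ e ≤ t) : minEffort δ t e = 0 := by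
  rw [minEffort, max_eq_left (sub_nonpos.2 h), zero_div]

lemma minEffort_of_ge (h : t ≤ δ e) : minEffort δ t e = (δ e - t) / δ e := by
  rw [minEffort, max_eq_right (sub_nonneg.2 h)]

lemma minEffort_nonneg (ht : 0 ≤ t) (e : E) : 0 ≤ minEffort δ t e := by
  rcases le_total (δ e) t with h | h
  · rw [minEffort_of_le h]
  · rw [minEffort_of_ge h]
    exact div_nonneg (sub_nonneg.2 h) (ht.trans h)

lemma minEffort_le_one (ht : 0 ≤ t) (e : E) : minEffort δ t e ≤ 1 := by
  rcases le_total (δ e) t with h | h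
  · rw [minEffort_of_le h]
    exact zero_le_one
  · rw [minEffort_of_ge h]
    exact div_le_one_of_le₀ (sub_le_self _ ht) (ht.trans h)

lemma one_sub_minEffort_mul (ht : 0 ≤ t) (e : E) :
    (1 - minEffort δ t e) * δ e = min t (δ e) := by
  rcases le_or_gt (δ e) t with h | h
  · rw [minEffort_of_le h, min_eq_right h, sub_zero, one_mul]
  · rw [minEffort_of_ge h.le, min_eq_left h.le, sub_mul, div_mul_cancel₀ _ (ht.trans_lt h).ne']
    ring

lemma one_sub_minEffort_mul_le (ht : 0 ≤ t) (e : E) : (1 - minEffort δ t e) * δ e ≤ t :=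
  (one_sub_minEffort_mul ht e).trans_le (min_le_left _ _)

lemma minEffort_le (ht : 0 ≤ t) (h0 : 0 ≤ ρ e) (h : (1 - ρ e) * δ e ≤ t) :
    minEffort δ t e ≤ ρ e := by
  rcases le_or_gt (δ e) t with hle | hlt
  · rwa [minEffort_of_le hle]
  · rw [minEffort_of_ge hlt.le, div_le_iff₀ (ht.trans_lt hlt)]
    linarith

lemma minEffort_anti (hs : 0 ≤ s) (h : s ≤ t) (e : E) : minEffort δ t e ≤ minEffort δ s e :=
  minEffort_le (hs.trans h) (minEffort_nonneg hs e) ((one_sub_minEffort_mul_le hs e).trans h)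

lemma minEffort_lt (hs : 0 ≤ s) (h : s < t) (he : s < δ e) :
    minEffort δ t e < minEffort δ s e := by
  have hδ : 0 < δ e := hs.trans_lt he
  rw [minEffort_of_ge he.le]
  exact div_lt_div_of_pos_right (max_lt (sub_pos.2 he) (sub_lt_sub_left h _)) hδ

lemma one_sub_div_le_minEffort (hδ : 0 < δ e) : 1 - t / δ e ≤ minEffort δ t e := by
  rw [one_sub_div hδ.ne']
  exact div_le_div_of_nonneg_right (le_max_right _ _) hδ.le

variable [Fintype E]

lemma expectedLoss_minEffort_eq_iff (ht : 0 < t) (τ : AttStrategy E) :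
    expectedLoss δ (minEffort δ t) τ = t ↔ AttacksWithin τ {e | t ≤ δ e} := by
  have hslack (e : E) : 0 ≤ τ.1 (some e) * (t - min t (δ e)) :=
    mul_nonneg (τ.2.1 _) (sub_nonneg.2 (min_le_left _ _))
  have hsplit : t - expectedLoss δ (minEffort δ t) τ
      = t * τ.1 none + ∑ e, τ.1 (some e) * (t - min t (δ e)) := by
    simp only [expectedLoss, one_sub_minEffort_mul ht.le, mul_sub, Finset.sum_sub_distrib,
      ← Finset.sum_mul, τ.sum_some]
    ring
  rw [eq_comm, ← sub_eq_zero, hsplit, add_eq_zero_iff_of_nonneg (mul_nonneg ht.le (τ.2.1 none))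
    (Finset.sum_nonneg fun e _ => hslack e), Finset.sum_eq_zero_iff_of_nonneg fun e _ => hslack e]
  simp [AttacksWithin, ht.ne', sub_eq_zero, or_iff_not_imp_right]

/-- The least total effort that brings the expected damage of every attack down to `t`. -/
noncomputable def minTotal (δ : E → ℝ) (t : ℝ) : ℝ :=
  ∑ e, minEffort δ t e

lemma minTotal_le (ht : 0 ≤ t) (h0 : ∀ e, 0 ≤ ρ e) (h : ∀ e, (1 - ρ e) * δ e ≤ t) :
    minTotal δ t ≤ ∑ e, ρ e :=
  Finset.sum_le_sum fun e _ => minEffort_le ht (h0 e) (h e)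

lemma eq_minEffort_of_sum_le (ht : 0 ≤ t) (h0 : ∀ e, 0 ≤ ρ e) (h : ∀ e, (1 - ρ e) * δ e ≤ t)
    (hsum : ∑ e, ρ e ≤ minTotal δ t) : ρ = minEffort δ t := by
  have hle (e : E) : minEffort δ t e ≤ ρ e := minEffort_le ht (h0 e) (h e)
  have heq := (Finset.sum_eq_sum_iff_of_le fun e _ => hle e).1
    (hsum.antisymm' (Finset.sum_le_sum fun e _ => hle e))
  exact funext fun e => (heq e (Finset.mem_univ e)).symm

lemma defenderCost_eq_of_attacksWithin {cd : ℝ} (ht : 0 < t) {τ : AttStrategy E}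
    (hτ : AttacksWithin τ {e | t ≤ δ e}) :
    defenderCost δ cd (minEffort δ t) τ = t + cd * minTotal δ t := by
  rw [defenderCost, (expectedLoss_minEffort_eq_iff ht τ).2 hτ, minTotal]

lemma continuous_minTotal : Continuous (minTotal δ) := by
  unfold minTotal minEffort
  fun_prop

lemma minTotal_nonneg (ht : 0 ≤ t) : 0 ≤ minTotal δ t :=
  Finset.sum_nonneg fun e _ => minEffort_nonneg ht e

lemma minTotal_anti (hs : 0 ≤ s) (h : s ≤ t) : minTotal δ t ≤ minTotal δ s :=
  Finset.sum_le_sum fun e _ => minEffort_anti hs h e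

lemma minTotal_lt (hs : 0 ≤ s) (h : s < t) (he : s < δ e) : minTotal δ t < minTotal δ s :=
  Finset.sum_lt_sum (fun e _ => minEffort_anti hs h.le e)
    ⟨e, Finset.mem_univ e, minEffort_lt hs h he⟩

end MinEffort

section Cut

variable {E : Type*} {δ : E → ℝ} {c d t x : ℝ} {A B : Finset E}

/-- `A` separates the damages at the level `x`, those equal to `x` being on either side. Cuts
describe the piecewise linear function `minTotal δ` near `x`. -/
def IsCut (δ : E → ℝ) (x : ℝ) (A : Finset E) : Prop :=
  (∀ e ∈ A, x ≤ δ e) ∧ ∀ e ∉ A, δ e ≤ x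

variable [Fintype E]

lemma card_sub_mul_sum_inv_le_minTotal (hA : ∀ e ∈ A, 0 < δ e) (ht : 0 ≤ t) :
    A.card - t * ∑ e ∈ A, (δ e)⁻¹ ≤ minTotal δ t :=
  calc A.card - t * ∑ e ∈ A, (δ e)⁻¹
      = ∑ e ∈ A, (1 - t / δ e) := by
        simp [Finset.mul_sum, div_eq_mul_inv]
    _ ≤ ∑ e ∈ A, minEffort δ t e :=
        Finset.sum_le_sum fun e he => one_sub_div_le_minEffort (hA e he)
    _ ≤ minTotal δ t :=
        Finset.sum_le_univ_sum_of_nonneg fun e => minEffort_nonneg ht e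

lemma IsCut.minTotal_eq (hA : IsCut δ x A) (hx : 0 < x) :
    minTotal δ x = A.card - x * ∑ e ∈ A, (δ e)⁻¹ :=
  calc minTotal δ x
      = ∑ e ∈ A, minEffort δ x e :=
        (Finset.sum_subset (Finset.subset_univ A) fun e _ he => minEffort_of_le (hA.2 e he)).symm
    _ = ∑ e ∈ A, (1 - x / δ e) := Finset.sum_congr rfl fun e he => by
        rw [minEffort_of_ge (hA.1 e he), one_sub_div (hx.trans_le (hA.1 e he)).ne']
    _ = A.card - x * ∑ e ∈ A, (δ e)⁻¹ := by
        simp [Finset.mul_sum, div_eq_mul_inv]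

/-- The reciprocal damages of a cut at `x` sum up to minus a subgradient of `minTotal δ` at `x`. -/
lemma IsCut.minTotal_add_le (hA : IsCut δ x A) (hx : 0 < x) (ht : 0 ≤ t) :
    minTotal δ x + (x - t) * ∑ e ∈ A, (δ e)⁻¹ ≤ minTotal δ t := by
  have h := card_sub_mul_sum_inv_le_minTotal (fun e he => hx.trans_le (hA.1 e he)) ht
  rw [hA.minTotal_eq hx]
  linarith

lemma add_mul_minTotal_le (hA : IsCut δ d A) (hB : IsCut δ d B) (hd : 0 < d) (hc : 0 ≤ c)
    (hcA : c * ∑ e ∈ A, (δ e)⁻¹ ≤ 1) (hcB : 1 ≤ c * ∑ e ∈ B, (δ e)⁻¹) (ht : 0 ≤ t) :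
    d + c * minTotal δ d ≤ t + c * minTotal δ t := by
  have hA' := mul_le_mul_of_nonneg_left (hA.minTotal_add_le hd ht) hc
  have hB' := mul_le_mul_of_nonneg_left (hB.minTotal_add_le hd ht) hc
  rcases le_total d t with h | h
  · linarith [mul_le_mul_of_nonneg_left hcA (sub_nonneg.2 h)]
  · linarith [mul_le_mul_of_nonneg_left hcB (sub_nonneg.2 h)]

lemma add_mul_minTotal_lt (hA : IsCut δ d A) (hB : IsCut δ d B) (hd : 0 < d) (hc : 0 ≤ c)
    (hcA : c * ∑ e ∈ A, (δ e)⁻¹ < 1) (hcB : 1 < c * ∑ e ∈ B, (δ e)⁻¹) (ht : 0 ≤ t)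
    (hne : t ≠ d) : d + c * minTotal δ d < t + c * minTotal δ t := by
  have hA' := mul_le_mul_of_nonneg_left (hA.minTotal_add_le hd ht) hc
  have hB' := mul_le_mul_of_nonneg_left (hB.minTotal_add_le hd ht) hc
  rcases hne.lt_or_gt with h | h
  · linarith [mul_lt_mul_of_pos_left hcB (sub_pos.2 h)]
  · linarith [mul_lt_mul_of_pos_left hcA (sub_pos.2 h)]

end Cut

section BreakEven

variable {E : Type*} [Fintype E] {δ : E → ℝ} {c c' d t x : ℝ}

/-- At the defense cost `c`, bringing all expected damages down to `x`, which deters an attacker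
whose attack cost is `x`, costs the defender exactly as much as the best way of being attacked:
being attacked at the level `t` costs `t + c * minTotal δ t`. -/
structure IsBreakEven (δ : E → ℝ) (x c : ℝ) : Prop where
  pos : 0 < c
  le_add : ∀ t ≥ 0, c * minTotal δ x ≤ t + c * minTotal δ t
  exists_eq : ∃ t > 0, c * minTotal δ x = t + c * minTotal δ t

lemma IsBreakEven.mul_minTotal_lt (h : IsBreakEven δ x c') (hc : 0 ≤ c) (hcc' : c < c')
    (ht : 0 < t) : c * minTotal δ x < t + c * minTotal δ t := by
  have hscaled := mul_le_mul_of_nonneg_left (h.le_add t ht.le) hc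
  have hlt : c * t < c' * t := mul_lt_mul_of_pos_right hcc' ht
  refine lt_of_mul_lt_mul_left ?_ h.pos.le
  linarith

lemma IsBreakEven.unique (h : IsBreakEven δ x c) (h' : IsBreakEven δ x c') : c = c' := by
  obtain ⟨t, ht, heq⟩ := h.exists_eq
  obtain ⟨t', ht', heq'⟩ := h'.exists_eq
  rcases lt_trichotomy c c' with hlt | rfl | hlt
  · exact absurd heq (h'.mul_minTotal_lt h.pos.le hlt ht).ne
  · rfl
  · exact absurd heq' (h.mul_minTotal_lt h'.pos.le hlt ht').ne

lemma exists_isBreakEven (hc : 0 < c) (hd : 0 < d)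
    (hle : ∀ t ≥ 0, d + c * minTotal δ d ≤ t + c * minTotal δ t)
    (hlt : d + c * minTotal δ d < c * minTotal δ 0) : ∃ x ∈ Set.Ioo 0 d, IsBreakEven δ x c := by
  have hcont : ContinuousOn (fun x => c * minTotal δ x) (Set.Icc 0 d) :=
    (continuous_const.mul continuous_minTotal).continuousOn
  obtain ⟨x, hx, heq⟩ :=
    intermediate_value_Ioo' hd.le hcont ⟨lt_add_of_pos_left (c * minTotal δ d) hd, hlt⟩
  exact ⟨x, hx, hc, fun t ht => heq.trans_le (hle t ht), d, hd, heq⟩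

lemma isBreakEven_of_isCut {A B : Finset E} (hA : IsCut δ d A) (hB : IsCut δ d B) (hd : 0 < d)
    (hx : minTotal δ x ∈ Set.Ioc (A.card : ℝ) B.card) :
    IsBreakEven δ x (d / (minTotal δ x - minTotal δ d)) := by
  have hNA := hA.minTotal_eq hd
  have hNB := hB.minTotal_eq hd
  have hSA : 0 ≤ d * ∑ e ∈ A, (δ e)⁻¹ :=
    mul_nonneg hd.le (Finset.sum_nonneg fun e he => inv_nonneg.2 (hd.le.trans (hA.1 e he)))
  have hD : 0 < minTotal δ x - minTotal δ d := by linarith [hx.1]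
  have hcA : d / (minTotal δ x - minTotal δ d) * ∑ e ∈ A, (δ e)⁻¹ ≤ 1 := by
    rw [div_mul_eq_mul_div, div_le_one hD]
    linarith [hx.1]
  have hcB : 1 ≤ d / (minTotal δ x - minTotal δ d) * ∑ e ∈ B, (δ e)⁻¹ := by
    rw [div_mul_eq_mul_div, one_le_div hD]
    linarith [hx.2]
  have heq : d / (minTotal δ x - minTotal δ d) * minTotal δ x
      = d + d / (minTotal δ x - minTotal δ d) * minTotal δ d := by
    rw [← sub_eq_iff_eq_add, ← mul_sub, div_mul_cancel₀ _ hD.ne']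
  have hc : 0 < d / (minTotal δ x - minTotal δ d) := div_pos hd hD
  exact ⟨hc, fun t ht => heq.trans_le (add_mul_minTotal_le hA hB hd hc.le hcA hcB ht), d, hd, heq⟩

end BreakEven

section Equilibrium

variable {E : Type*} [Fintype E] [DecidableEq E] {C0 : ℝ} {C : E → ℝ} {ca cd : ℝ}

lemma isSPE_iff {σd : DefStrategy E} {σa : DefStrategy E → AttStrategy E} :
    IsSPE C0 C ca cd σd σa ↔ (∀ σ, σa σ ∈ BR C0 C ca σ) ∧
      ∀ σ, defenderCost (damage C0 C) cd (effort σd) (σa σd)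
        ≤ defenderCost (damage C0 C) cd (effort σ) (σa σ) := by
  simp only [IsSPE, Ud_eq, sub_le_sub_iff_left, BR, Set.mem_ofPred_eq, and_comm]

lemma isNE_iff {σ : DefStrategy E} {τ : AttStrategy E} :
    IsNE C0 C ca cd σ τ ↔ τ ∈ BR C0 C ca σ ∧
      ∀ σ', defenderCost (damage C0 C) cd (effort σ) τ
        ≤ defenderCost (damage C0 C) cd (effort σ') τ := by
  simp only [IsNE, Ud_eq, sub_le_sub_iff_left, BR, Set.mem_ofPred_eq, and_comm]

/-- The solution of the defender's problem of committing to a strategy that minimizes her cost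
against an optimally replying attacker: the value is `v`, and it is attained precisely by the
effort vector `ρ` together with replies satisfying `P`. By `exists_lt` the defender can come
arbitrarily close to `v` however the attacker breaks ties. -/
structure IsStackelbergSolution (C0 : ℝ) (C : E → ℝ) (ca cd : ℝ) (ρ : E → ℝ)
    (P : AttStrategy E → Prop) (v : ℝ) : Prop where
  value_le : ∀ σ, ∀ τ ∈ BR C0 C ca σ, v ≤ defenderCost (damage C0 C) cd (effort σ) τ
  exists_lt : ∀ v' > v, ∃ σ, ∀ τ ∈ BR C0 C ca σ,
    defenderCost (damage C0 C) cd (effort σ) τ < v'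
  attained_iff : ∀ σ τ, τ ∈ BR C0 C ca σ ∧ defenderCost (damage C0 C) cd (effort σ) τ = v ↔
    effort σ = ρ ∧ P τ

namespace IsStackelbergSolution

variable {ρ : E → ℝ} {P : AttStrategy E → Prop} {v : ℝ}

lemma isSPE_iff (h : IsStackelbergSolution C0 C ca cd ρ P v) (σd : DefStrategy E)
    (σa : DefStrategy E → AttStrategy E) :
    IsSPE C0 C ca cd σd σa ↔
      effort σd = ρ ∧ P (σa σd) ∧ ∀ σ ≠ σd, σa σ ∈ BR C0 C ca σ := by
  rw [SecurityGame.isSPE_iff, ← and_assoc, ← h.attained_iff]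
  constructor
  · rintro ⟨hBR, hmin⟩
    have hle : defenderCost (damage C0 C) cd (effort σd) (σa σd) ≤ v := by
      refine le_of_forall_gt_imp_ge_of_dense fun v' hv' => ?_
      obtain ⟨σ, hσ⟩ := h.exists_lt v' hv'
      exact (hmin σ).trans (hσ _ (hBR σ)).le
    exact ⟨⟨hBR σd, hle.antisymm (h.value_le _ _ (hBR σd))⟩, fun σ _ => hBR σ⟩
  · rintro ⟨⟨hBRd, heq⟩, hBR⟩
    have hBR' (σ : DefStrategy E) : σa σ ∈ BR C0 C ca σ := by
      rcases eq_or_ne σ σd with rfl | hne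
      exacts [hBRd, hBR σ hne]
    exact ⟨hBR', fun σ => heq.trans_le (h.value_le _ _ (hBR' σ))⟩

lemma speEfforts_eq (h : IsStackelbergSolution C0 C ca cd ρ P v) {σd : DefStrategy E}
    (hσd : effort σd = ρ) {τ : AttStrategy E} (hτ : P τ) : speEfforts C0 C ca cd = {ρ} := by
  classical
  choose σa hσa using BR_nonempty C0 C ca
  refine Set.Subset.antisymm ?_ (Set.singleton_subset_iff.2
    ⟨σd, Function.update σa σd τ, (h.isSPE_iff _ _).2 ⟨hσd, ?_, fun σ hσ => ?_⟩, hσd⟩)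
  · rintro _ ⟨σ, σa', hSPE, rfl⟩
    exact ((h.isSPE_iff σ σa').1 hSPE).1
  · rwa [Function.update_self]
  · rw [Function.update_of_ne hσ]
    exact hσa σ

end IsStackelbergSolution

lemma exists_effort_eq_minEffort (δ : E → ℝ) {t : ℝ} (ht : 0 ≤ t) :
    ∃ σ : DefStrategy E, effort σ = minEffort δ t :=
  ⟨_, effort_independentDefense (minEffort_nonneg ht) (minEffort_le_one ht)⟩

lemma minTotal_le_sum_effort {δ : E → ℝ} {t : ℝ} (ht : 0 ≤ t) {σ : DefStrategy E}
    (hσ : ∀ e, (1 - effort σ e) * δ e ≤ t) : minTotal δ t ≤ ∑ e, effort σ e :=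
  minTotal_le ht (effort_nonneg σ) hσ

lemma deterrence_value_lt_or_eq_of_mem_BR (hca : 0 < ca) (hcd : 0 < cd)
    (hdeter : ∀ t > ca, cd * minTotal (damage C0 C) ca < t + cd * minTotal (damage C0 C) t)
    {σ : DefStrategy E} {τ : AttStrategy E} (hτ : τ ∈ BR C0 C ca σ) :
    cd * minTotal (damage C0 C) ca < defenderCost (damage C0 C) cd (effort σ) τ ∨
      effort σ = minEffort (damage C0 C) ca ∧ τ.1 none = 1 := by
  obtain ⟨t, hcat, hthreat, hloss, hnone⟩ := mem_BR_iff.1 hτ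
  have htotal := mul_le_mul_of_nonneg_left
    (minTotal_le_sum_effort (hca.le.trans hcat) hthreat) hcd.le
  rw [defenderCost, hloss]
  rcases hcat.eq_or_lt with rfl | hlt
  · refine or_iff_not_imp_left.2 fun hle => ?_
    have hattack : 0 ≤ ca * (1 - τ.1 none) :=
      mul_nonneg hca.le (sub_nonneg.2 (stdSimplex.le_one τ none))
    refine ⟨eq_minEffort_of_sum_le hca.le (effort_nonneg σ) hthreat
      (le_of_mul_le_mul_left (by linarith) hcd), ?_⟩
    exact (sub_eq_zero.1 ((mul_eq_zero.1 (by linarith)).resolve_left hca.ne')).symm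
  · left
    rw [hnone hlt]
    linarith [hdeter t hlt]

/-- Against `minEffort δ ca` itself the attacker may still attack, but slightly higher efforts
force him to give up. -/
theorem isStackelbergSolution_of_deterrence (hca : 0 < ca) (hcd : 0 < cd)
    (hdeter : ∀ t > ca, cd * minTotal (damage C0 C) ca < t + cd * minTotal (damage C0 C) t) :
    IsStackelbergSolution C0 C ca cd (minEffort (damage C0 C) ca) (fun τ => τ.1 none = 1)
      (cd * minTotal (damage C0 C) ca) := by
  have hattained {σ : DefStrategy E} {τ : AttStrategy E}
      (h : effort σ = minEffort (damage C0 C) ca ∧ τ.1 none = 1) :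
      defenderCost (damage C0 C) cd (effort σ) τ = cd * minTotal (damage C0 C) ca := by
    rw [defenderCost_eq_of_none_eq_one h.2, h.1, minTotal]
  constructor
  · intro σ τ hτ
    exact (deterrence_value_lt_or_eq_of_mem_BR hca hcd hdeter hτ).elim le_of_lt
      fun h => (hattained h).ge
  · intro v' hv'
    have hnear : ∀ᶠ t in nhdsWithin ca (Set.Iio ca), cd * minTotal (damage C0 C) t < v' :=
      nhdsWithin_le_nhds
        ((continuous_minTotal.const_mul cd).continuousAt.eventually_lt_const hv')
    obtain ⟨t, hlt, ht, htca⟩ := (hnear.and (Ioo_mem_nhdsLT hca)).exists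
    obtain ⟨σ, hσ⟩ := exists_effort_eq_minEffort (damage C0 C) ht.le
    refine ⟨σ, fun τ hτ => ?_⟩
    rw [mem_BR_iff_none_eq_one htca (by simpa only [hσ] using one_sub_minEffort_mul_le ht.le)] at hτ
    rwa [defenderCost_eq_of_none_eq_one hτ, hσ]
  · refine fun σ τ => ⟨fun ⟨hτ, heq⟩ => ?_, fun h => ⟨?_, hattained h⟩⟩
    · exact (deterrence_value_lt_or_eq_of_mem_BR hca hcd hdeter hτ).resolve_left heq.not_gt
    · exact mem_BR_of_none_eq_one (by simpa only [h.1] using one_sub_minEffort_mul_le hca.le) h.2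

lemma mem_BR_iff_attacksWithin {d : ℝ} (hd : 0 < d) (hcad : ca < d)
    (hex : ∃ e, damage C0 C e = d) {σ : DefStrategy E}
    (hσ : effort σ = minEffort (damage C0 C) d) (τ : AttStrategy E) :
    τ ∈ BR C0 C ca σ ↔ AttacksWithin τ {e | d ≤ damage C0 C e} := by
  rw [← expectedLoss_minEffort_eq_iff hd, mem_BR_iff, hσ]
  constructor
  · rintro ⟨t, -, hthreat, hloss, hnone⟩
    obtain ⟨e, he⟩ := hex
    have hdt : d ≤ t := by
      have hle := hthreat e
      rwa [one_sub_minEffort_mul hd.le, he, min_self] at hle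
    have hloss_le := expectedLoss_le (one_sub_minEffort_mul_le (δ := damage C0 C) hd.le) τ
    rw [hnone (hcad.trans_le hdt), sub_zero, mul_one] at hloss hloss_le
    exact hloss_le.antisymm (hdt.trans_eq hloss.symm)
  · intro hloss
    have hnone := ((expectedLoss_minEffort_eq_iff hd τ).1 hloss).1
    exact ⟨d, hcad.le, one_sub_minEffort_mul_le hd.le, by rw [hloss, hnone, sub_zero, mul_one],
      fun _ => hnone⟩

lemma tolerance_value_lt_or_eq_of_mem_BR {d : ℝ} (hca : 0 < ca) (hcd : 0 < cd) (hcad : ca < d)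
    (hdeter : d + cd * minTotal (damage C0 C) d < cd * minTotal (damage C0 C) ca)
    (hopt : ∀ t ≥ 0, t ≠ d →
      d + cd * minTotal (damage C0 C) d < t + cd * minTotal (damage C0 C) t)
    {σ : DefStrategy E} {τ : AttStrategy E} (hτ : τ ∈ BR C0 C ca σ) :
    d + cd * minTotal (damage C0 C) d < defenderCost (damage C0 C) cd (effort σ) τ ∨
      effort σ = minEffort (damage C0 C) d := by
  obtain ⟨t, hcat, hthreat, hloss, hnone⟩ := mem_BR_iff.1 hτ
  have ht : 0 ≤ t := hca.le.trans hcat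
  have htotal := mul_le_mul_of_nonneg_left (minTotal_le_sum_effort ht hthreat) hcd.le
  rw [defenderCost, hloss]
  rcases hcat.eq_or_lt with rfl | hlt
  · have hattack : 0 ≤ ca * (1 - τ.1 none) :=
      mul_nonneg hca.le (sub_nonneg.2 (stdSimplex.le_one τ none))
    exact Or.inl (by linarith)
  · rw [hnone hlt, sub_zero, mul_one]
    rcases eq_or_ne t d with rfl | hne
    · refine or_iff_not_imp_left.2 fun hle => ?_
      exact eq_minEffort_of_sum_le ht (effort_nonneg σ) hthreat
        (le_of_mul_le_mul_left (by linarith) hcd)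
    · exact Or.inl ((hopt t ht hne).trans_le (by linarith))

theorem isStackelbergSolution_of_tolerance {d : ℝ} (hca : 0 < ca) (hcd : 0 < cd) (hcad : ca < d)
    (hex : ∃ e, damage C0 C e = d)
    (hdeter : d + cd * minTotal (damage C0 C) d < cd * minTotal (damage C0 C) ca)
    (hopt : ∀ t ≥ 0, t ≠ d →
      d + cd * minTotal (damage C0 C) d < t + cd * minTotal (damage C0 C) t) :
    IsStackelbergSolution C0 C ca cd (minEffort (damage C0 C) d)
      (fun τ => AttacksWithin τ {e | d ≤ damage C0 C e})
      (d + cd * minTotal (damage C0 C) d) := by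
  have hd : 0 < d := hca.trans hcad
  have hattained {σ : DefStrategy E} {τ : AttStrategy E}
      (hσ : effort σ = minEffort (damage C0 C) d) (hτ : τ ∈ BR C0 C ca σ) :
      defenderCost (damage C0 C) cd (effort σ) τ = d + cd * minTotal (damage C0 C) d := by
    rw [hσ, defenderCost_eq_of_attacksWithin hd ((mem_BR_iff_attacksWithin hd hcad hex hσ τ).1 hτ)]
  constructor
  · intro σ τ hτ
    exact (tolerance_value_lt_or_eq_of_mem_BR hca hcd hcad hdeter hopt hτ).elim le_of_lt
      fun hσ => (hattained hσ hτ).ge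
  · intro v' hv'
    obtain ⟨σ, hσ⟩ := exists_effort_eq_minEffort (damage C0 C) hd.le
    exact ⟨σ, fun τ hτ => (hattained hσ hτ).trans_lt hv'⟩
  · refine fun σ τ => ⟨fun ⟨hτ, heq⟩ => ?_, fun ⟨hσ, hτ⟩ => ?_⟩
    · have hσ := (tolerance_value_lt_or_eq_of_mem_BR hca hcd hcad hdeter hopt hτ).resolve_left
        heq.not_gt
      exact ⟨hσ, (mem_BR_iff_attacksWithin hd hcad hex hσ τ).1 hτ⟩
    · have hBR := (mem_BR_iff_attacksWithin hd hcad hex hσ τ).2 hτ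
      exact ⟨hBR, hattained hσ hBR⟩

end Equilibrium

section Nash

variable {E : Type*} [Fintype E] {δ ρ : E → ℝ} {c d : ℝ}

lemma defenderCost_eq_sum_add_sum (τ : AttStrategy E) :
    defenderCost δ c ρ τ
      = ∑ e, τ.1 (some e) * δ e + ∑ e, ρ e * (c - τ.1 (some e) * δ e) := by
  rw [defenderCost, expectedLoss, Finset.mul_sum, ← Finset.sum_add_distrib,
    ← Finset.sum_add_distrib]
  exact Finset.sum_congr rfl fun e _ => by ring

lemma defenderCost_minEffort_le {τ : AttStrategy E} (hle : ∀ e, τ.1 (some e) * δ e ≤ c)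
    (heq : ∀ e, d < δ e → τ.1 (some e) * δ e = c) (hρ : ∀ e, 0 ≤ ρ e) :
    defenderCost δ c (minEffort δ d) τ ≤ defenderCost δ c ρ τ := by
  have hzero : ∑ e, minEffort δ d e * (c - τ.1 (some e) * δ e) = 0 :=
    Finset.sum_eq_zero fun e _ => by
      rcases le_or_gt (δ e) d with h | h
      · rw [minEffort_of_le h, zero_mul]
      · rw [heq e h, sub_self, mul_zero]
  rw [defenderCost_eq_sum_add_sum, defenderCost_eq_sum_add_sum, hzero, add_le_add_iff_left]
  exact Finset.sum_nonneg fun e _ => mul_nonneg (hρ e) (sub_nonneg.2 (hle e))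

lemma exists_fractional_cut {A B : Finset E} (hA : IsCut δ d A) (hB : IsCut δ d B)
    (hcA : c * ∑ e ∈ A, (δ e)⁻¹ ≤ 1) (hcB : 1 ≤ c * ∑ e ∈ B, (δ e)⁻¹) :
    ∃ s : E → ℝ, (∀ e, s e ∈ Set.Icc 0 1) ∧ (∀ e, δ e < d → s e = 0) ∧
      (∀ e, d < δ e → s e = 1) ∧ c * ∑ e, s e * (δ e)⁻¹ = 1 := by
  classical
  obtain ⟨a, b, ha, hb, hab, hsum⟩ :
      (1 : ℝ) ∈ segment ℝ (c * ∑ e ∈ A, (δ e)⁻¹) (c * ∑ e ∈ B, (δ e)⁻¹) := by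
    rw [segment_eq_Icc (hcA.trans hcB)]
    exact ⟨hcA, hcB⟩
  refine ⟨fun e => (if e ∈ A then a else 0) + if e ∈ B then b else 0, fun e => ?_,
    fun e he => ?_, fun e he => ?_, ?_⟩
  · constructor <;> dsimp only <;> split_ifs <;> linarith
  · have hnotMem {D : Finset E} (hD : IsCut δ d D) : e ∉ D := fun h => (hD.1 e h).not_gt he
    simp only [hnotMem hA, hnotMem hB, if_false, add_zero]
  · have hmem {D : Finset E} (hD : IsCut δ d D) : e ∈ D :=
      by_contra fun h => (hD.2 e h).not_gt he
    simp only [hmem hA, hmem hB, if_true, hab]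
  · rw [← hsum]
    simp only [add_mul, ite_mul, zero_mul, Finset.sum_add_distrib, Finset.sum_ite_mem,
      Finset.univ_inter, ← Finset.mul_sum, smul_eq_mul]
    ring

/-- The attacker makes the defender indifferent about securing the facilities with damage above `d`
by attacking each such `e` with probability `c / δ e`; the facilities with damage `d` absorb the
remaining probability. -/
lemma exists_attStrategy_mul_eq {A B : Finset E} (hA : IsCut δ d A) (hB : IsCut δ d B)
    (hd : 0 < d) (hc : 0 ≤ c) (hcA : c * ∑ e ∈ A, (δ e)⁻¹ ≤ 1)
    (hcB : 1 ≤ c * ∑ e ∈ B, (δ e)⁻¹) :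
    ∃ τ : AttStrategy E, AttacksWithin τ {e | d ≤ δ e} ∧ (∀ e, τ.1 (some e) * δ e ≤ c) ∧
      ∀ e, d < δ e → τ.1 (some e) * δ e = c := by
  obtain ⟨s, hs, hlow, hhigh, hsum⟩ := exists_fractional_cut hA hB hcA hcB
  have hnonneg (e : E) : 0 ≤ c * (s e * (δ e)⁻¹) := by
    rcases lt_or_ge (δ e) d with he | he
    · simp only [hlow e he, zero_mul, mul_zero, le_refl]
    · exact mul_nonneg hc (mul_nonneg (hs e).1 (inv_nonneg.2 (hd.le.trans he)))
  have hmul (e : E) : c * (s e * (δ e)⁻¹) * δ e = c * s e := by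
    rcases eq_or_ne (δ e) 0 with h | h
    · simp only [hlow e (h.trans_lt hd), zero_mul, mul_zero]
    · rw [mul_assoc, inv_mul_cancel_right₀ h]
  refine ⟨⟨fun x => x.elim 0 fun e => c * (s e * (δ e)⁻¹), ?_, ?_⟩, ⟨rfl, fun e he => ?_⟩,
    fun e => ?_, fun e he => ?_⟩
  · rintro (_ | e)
    exacts [le_rfl, hnonneg e]
  · simpa [Fintype.sum_option, Finset.mul_sum] using hsum
  · have hlt : δ e < d := by simpa using he
    simp [hlow e hlt]
  · exact (hmul e).trans_le (mul_le_of_le_one_right hc (hs e).2)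
  · exact (hmul e).trans (by rw [hhigh e he, mul_one])

variable [DecidableEq E] {C0 : ℝ} {C : E → ℝ} {ca cd : ℝ}

theorem IsStackelbergSolution.neEfforts_eq {P : AttStrategy E → Prop}
    (h : IsStackelbergSolution C0 C ca cd (minEffort (damage C0 C) d) P
      (d + cd * minTotal (damage C0 C) d))
    (hd : 0 < d) (hcad : ca < d) (hex : ∃ e, damage C0 C e = d) {τ : AttStrategy E}
    (hτ : AttacksWithin τ {e | d ≤ damage C0 C e})
    (hle : ∀ e, τ.1 (some e) * damage C0 C e ≤ cd)
    (heq : ∀ e, d < damage C0 C e → τ.1 (some e) * damage C0 C e = cd) :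
    neEfforts C0 C ca cd = {minEffort (damage C0 C) d} := by
  obtain ⟨σs, hσs⟩ := exists_effort_eq_minEffort (damage C0 C) hd.le
  refine Set.Subset.antisymm ?_ (Set.singleton_subset_iff.2 ⟨σs, τ, isNE_iff.2 ⟨?_, ?_⟩, hσs⟩)
  · rintro _ ⟨σ, τ', hNE, rfl⟩
    obtain ⟨hBR, hmin⟩ := isNE_iff.1 hNE
    have hvalue : defenderCost (damage C0 C) cd (effort σ) τ'
        ≤ d + cd * minTotal (damage C0 C) d := by
      refine (hmin σs).trans ?_
      rw [hσs, defenderCost, ← minTotal, add_le_add_iff_right]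
      exact (expectedLoss_le (one_sub_minEffort_mul_le hd.le) τ').trans
        (mul_le_of_le_one_right hd.le (sub_le_self _ (τ'.2.1 none)))
    exact ((h.attained_iff σ τ').1 ⟨hBR, hvalue.antisymm (h.value_le σ τ' hBR)⟩).1
  · exact (mem_BR_iff_attacksWithin hd hcad hex hσs τ).2 hτ
  · intro σ
    rw [hσs]
    exact defenderCost_minEffort_le hle heq (effort_nonneg σ)

end Nash

section Ordering

variable {E : Type*} [Fintype E] {C0 : ℝ} {C : E → ℝ} {i j k : ℕ} {e : E} {d x : ℝ}

lemma ordCost_eq_getElem (h : k - 1 < ((costValues C0 C).sort (· ≥ ·)).length) :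
    ordCost C0 C k = ((costValues C0 C).sort (· ≥ ·))[k - 1] :=
  List.getD_eq_getElem _ _ h

lemma ordCost_of_numValues_lt (h : numValues C0 C < k) : ordCost C0 C k = C0 := by
  refine List.getD_eq_default _ _ ?_
  rw [Finset.length_sort]
  exact Nat.le_sub_one_of_lt h

lemma le_numValues_of_lt_ordCost (h : C0 < ordCost C0 C k) : k ≤ numValues C0 C :=
  not_lt.1 fun hlt => h.ne' (ordCost_of_numValues_lt hlt)

lemma exists_eq_ordCost (h1 : 1 ≤ k) (hk : k ≤ numValues C0 C) :
    ∃ e, C0 < C e ∧ C e = ordCost C0 C k := by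
  have hlt : k - 1 < ((costValues C0 C).sort (· ≥ ·)).length := by
    rw [Finset.length_sort]
    exact Nat.sub_one_lt_of_le h1 hk
  have hmem : ordCost C0 C k ∈ costValues C0 C := by
    rw [ordCost_eq_getElem hlt, ← Finset.mem_sort (· ≥ ·)]
    exact List.getElem_mem hlt
  simpa [costValues, Ebar] using hmem

lemma exists_damage_eq (h1 : 1 ≤ k) (hk : k ≤ numValues C0 C) :
    ∃ e, damage C0 C e = ordCost C0 C k - C0 := by
  obtain ⟨e, -, he⟩ := exists_eq_ordCost h1 hk
  exact ⟨e, by rw [damage, he]⟩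

lemma exists_ordCost_eq (he : C0 < C e) : ∃ k, 1 ≤ k ∧ C e = ordCost C0 C k := by
  have hmem : C e ∈ (costValues C0 C).sort (· ≥ ·) := by
    rw [Finset.mem_sort, costValues]
    exact Finset.mem_image_of_mem C (by simpa [Ebar] using he)
  obtain ⟨n, hn, heq⟩ := List.getElem_of_mem hmem
  exact ⟨n + 1, Nat.le_add_left 1 n, by rw [ordCost_eq_getElem hn]; exact heq.symm⟩

lemma lt_ordCost (h1 : 1 ≤ k) (hk : k ≤ numValues C0 C) : C0 < ordCost C0 C k := by
  obtain ⟨e, he, heq⟩ := exists_eq_ordCost h1 hk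
  rwa [← heq]

lemma le_ordCost (h1 : 1 ≤ k) : C0 ≤ ordCost C0 C k := by
  rcases le_or_gt k (numValues C0 C) with hk | hk
  · exact (lt_ordCost h1 hk).le
  · exact (ordCost_of_numValues_lt hk).ge

lemma ordCost_lt_ordCost (h1 : 1 ≤ j) (hj : j ≤ numValues C0 C) (hjk : j < k) :
    ordCost C0 C k < ordCost C0 C j := by
  rcases le_or_gt k (numValues C0 C) with hk | hk
  · have hlt : k - 1 < ((costValues C0 C).sort (· ≥ ·)).length := by
      rw [Finset.length_sort]
      exact Nat.sub_one_lt_of_le (h1.trans hjk.le) hk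
    have hjk' : j - 1 < k - 1 := Nat.sub_lt_sub_right h1 hjk
    rw [ordCost_eq_getElem hlt, ordCost_eq_getElem (hjk'.trans hlt)]
    exact List.pairwise_iff_getElem.1 (Finset.sortedGT_sort (costValues C0 C)).pairwise _ _ _ _ hjk'
  · rw [ordCost_of_numValues_lt hk]
    exact lt_ordCost h1 hj

/-- By truncated subtraction, the value at `k = 0` is `C_(1)`. -/
lemma antitone_ordCost : Antitone (ordCost C0 C) := by
  refine antitone_nat_of_succ_le fun k => ?_
  rcases Nat.eq_zero_or_pos k with rfl | h1
  · rfl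
  · rcases le_or_gt k (numValues C0 C) with hk | hk
    · exact (ordCost_lt_ordCost h1 hk k.lt_succ_self).le
    · rw [ordCost_of_numValues_lt hk, ordCost_of_numValues_lt (hk.trans k.lt_succ_self)]

lemma damage_le_ordCost_one_sub (C0 : ℝ) (C : E → ℝ) (e : E) :
    damage C0 C e ≤ ordCost C0 C 1 - C0 := by
  refine sub_le_sub_right ?_ C0
  rcases lt_or_ge C0 (C e) with he | he
  · obtain ⟨k, h1, heq⟩ := exists_ordCost_eq he
    exact heq.trans_le (antitone_ordCost h1)
  · exact he.trans (le_ordCost le_rfl)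

lemma mem_group : e ∈ group C0 C k ↔ C0 < C e ∧ C e = ordCost C0 C k := by
  simp [group, Ebar]

lemma pairwiseDisjoint_group (i : ℕ) :
    (Finset.Icc 1 i : Set ℕ).PairwiseDisjoint (group C0 C) := by
  intro j hj k hk hne
  wlog hjk : j < k generalizing j k
  · exact (this hk hj hne.symm (hne.lt_or_gt.resolve_left hjk)).symm
  · refine Finset.disjoint_left.2 fun e hej hek => ?_
    obtain ⟨he, hj'⟩ := mem_group.1 hej
    have hjK : j ≤ numValues C0 C := le_numValues_of_lt_ordCost (hj' ▸ he)
    exact (ordCost_lt_ordCost (Finset.mem_Icc.1 hj).1 hjK hjk).ne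
      ((mem_group.1 hek).2.symm.trans hj')

lemma groupCard_pos (h1 : 1 ≤ k) (hk : k ≤ numValues C0 C) : 0 < groupCard C0 C k := by
  obtain ⟨e, he⟩ := exists_eq_ordCost h1 hk
  exact Nat.cast_pos.2 (Finset.card_pos.2 ⟨e, mem_group.2 he⟩)

lemma invSum_pos (h1 : 1 ≤ i) (hi : i ≤ numValues C0 C) : 0 < invSum C0 C i := by
  refine Finset.sum_pos (fun k hk => ?_) (Finset.nonempty_Icc.2 h1)
  obtain ⟨h1k, hki⟩ := Finset.mem_Icc.1 hk
  exact div_pos (groupCard_pos h1k (hki.trans hi)) (sub_pos.2 (lt_ordCost h1k (hki.trans hi)))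

variable [DecidableEq E]

lemma topGroups_zero : topGroups C0 C 0 = ∅ :=
  rfl

lemma topGroups_one : topGroups C0 C 1 = group C0 C 1 := by
  simp [topGroups]

lemma isCut_topGroups (hlo : ordCost C0 C (i + 1) - C0 ≤ x) (hhi : x ≤ ordCost C0 C i - C0) :
    IsCut (damage C0 C) x (topGroups C0 C i) := by
  constructor <;> intro e he
  · obtain ⟨k, hk, hek⟩ := Finset.mem_biUnion.1 he
    refine hhi.trans (sub_le_sub_right ?_ C0)
    rw [(mem_group.1 hek).2]
    exact antitone_ordCost (Finset.mem_Icc.1 hk).2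
  · refine le_trans (sub_le_sub_right ?_ C0) hlo
    rcases lt_or_ge C0 (C e) with hlt | hle
    · obtain ⟨k, h1, heq⟩ := exists_ordCost_eq hlt
      have hik : i < k := not_le.1 fun h =>
        he (Finset.mem_biUnion.2 ⟨k, Finset.mem_Icc.2 ⟨h1, h⟩, mem_group.2 ⟨hlt, heq⟩⟩)
      exact heq.trans_le (antitone_ordCost hik)
    · exact hle.trans (le_ordCost (Nat.le_add_left 1 i))

lemma isCut_topGroups_self (j : ℕ) :
    IsCut (damage C0 C) (ordCost C0 C j - C0) (topGroups C0 C j) :=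
  isCut_topGroups (sub_le_sub_right (antitone_ordCost j.le_succ) C0) le_rfl

lemma isCut_topGroups_pred (h1 : 1 ≤ j) :
    IsCut (damage C0 C) (ordCost C0 C j - C0) (topGroups C0 C (j - 1)) :=
  isCut_topGroups (by rw [Nat.sub_add_cancel h1])
    (sub_le_sub_right (antitone_ordCost (Nat.sub_le j 1)) C0)

lemma topGroups_eq_filter (h1 : 1 ≤ j) (hj : j ≤ numValues C0 C) :
    topGroups C0 C j = ({e : E | ordCost C0 C j - C0 ≤ damage C0 C e} : Finset E) := by
  refine Finset.ext fun e => ?_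
  rw [Finset.mem_filter_univ]
  refine ⟨(isCut_topGroups_self j).1 e, fun hle => ?_⟩
  rw [damage, sub_le_sub_iff_right] at hle
  have hlt : C0 < C e := (lt_ordCost h1 hj).trans_le hle
  obtain ⟨k, h1k, heq⟩ := exists_ordCost_eq hlt
  have hkj : k ≤ j := not_lt.1 fun h => (ordCost_lt_ordCost h1 hj h).not_ge (heq ▸ hle)
  exact Finset.mem_biUnion.2 ⟨k, Finset.mem_Icc.2 ⟨h1k, hkj⟩, mem_group.2 ⟨hlt, heq⟩⟩

lemma eq_minEffort_iff (hlo : ordCost C0 C (i + 1) - C0 ≤ x)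
    (hhi : x ≤ ordCost C0 C i - C0) {ρ : E → ℝ} :
    ρ = minEffort (damage C0 C) x ↔
      (∀ k ∈ Finset.Icc 1 i, ∀ e ∈ group C0 C k,
        ρ e = (ordCost C0 C k - x - C0) / (ordCost C0 C k - C0)) ∧
      ∀ e, e ∉ topGroups C0 C i → ρ e = 0 := by
  have hcut := isCut_topGroups hlo hhi
  have hmem {k : ℕ} (hk : k ∈ Finset.Icc 1 i) {e : E} (he : e ∈ group C0 C k) :
      minEffort (damage C0 C) x e = (ordCost C0 C k - x - C0) / (ordCost C0 C k - C0) := by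
    rw [minEffort_of_ge (hcut.1 e (Finset.mem_biUnion.2 ⟨k, hk, he⟩)), damage,
      (mem_group.1 he).2, sub_right_comm]
  have hnotMem {e : E} (he : e ∉ topGroups C0 C i) : minEffort (damage C0 C) x e = 0 :=
    minEffort_of_le (hcut.2 e he)
  constructor
  · rintro rfl
    exact ⟨fun k hk e he => hmem hk he, fun e he => hnotMem he⟩
  · rintro ⟨hgroup, hzero⟩
    funext e
    by_cases he : e ∈ topGroups C0 C i
    · obtain ⟨k, hk, hek⟩ := Finset.mem_biUnion.1 he
      rw [hgroup k hk e hek, hmem hk hek]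
    · rw [hzero e he, hnotMem he]

lemma invSum_eq_sum_topGroups (i : ℕ) :
    invSum C0 C i = ∑ e ∈ topGroups C0 C i, (damage C0 C e)⁻¹ := by
  rw [topGroups, Finset.sum_biUnion (pairwiseDisjoint_group i), invSum]
  refine Finset.sum_congr rfl fun k _ => ?_
  rw [Finset.sum_congr rfl fun e he => by rw [damage, (mem_group.1 he).2], Finset.sum_const,
    nsmul_eq_mul, groupCard, div_eq_mul_inv]

lemma sum_groupCard_eq_card (i : ℕ) :
    ∑ k ∈ Finset.Icc 1 i, groupCard C0 C k = (topGroups C0 C i).card := by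
  rw [topGroups, Finset.card_biUnion (pairwiseDisjoint_group i), Nat.cast_sum]
  rfl

lemma sum_groupCard_eq_card_sub_card (h : j ≤ i) :
    ∑ k ∈ Finset.Icc (j + 1) i, groupCard C0 C k
      = (topGroups C0 C i).card - (topGroups C0 C j).card := by
  rw [← sum_groupCard_eq_card, ← sum_groupCard_eq_card, eq_sub_iff_add_eq',
    ← Finset.sum_union (Finset.disjoint_left.2 fun k => by simp only [Finset.mem_Icc]; omega)]
  congr 1
  ext k
  simp only [Finset.mem_union, Finset.mem_Icc]
  omega

lemma monotone_card_topGroups : Monotone fun j => ((topGroups C0 C j).card : ℝ) := fun _ _ h =>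
  Nat.cast_le.2 (Finset.card_le_card
    (Finset.biUnion_subset_biUnion_of_subset_left _ (Finset.Icc_subset_Icc_right h)))

lemma minTotal_eq_card_sub (h0 : 0 < x) (hlo : ordCost C0 C (i + 1) - C0 ≤ x)
    (hhi : x ≤ ordCost C0 C i - C0) :
    minTotal (damage C0 C) x = (topGroups C0 C i).card - x * invSum C0 C i := by
  rw [(isCut_topGroups hlo hhi).minTotal_eq h0, invSum_eq_sum_topGroups]

end Ordering

section Threshold

variable {E : Type*} [Fintype E] {C0 : ℝ} {C : E → ℝ} {i j : ℕ} {x : ℝ}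

lemma exists_mem_Ico_ordCost (h0 : 0 ≤ x) (hx : x < ordCost C0 C 1 - C0) :
    ∃ i, 1 ≤ i ∧ x ∈ Set.Ico (ordCost C0 C (i + 1) - C0) (ordCost C0 C i - C0) := by
  obtain ⟨i, hi, hi'⟩ := Nat.exists_not_and_succ_of_not_zero_of_exists
    (p := fun i => ordCost C0 C i - C0 ≤ x) hx.not_ge
    ⟨numValues C0 C + 1, by rwa [ordCost_of_numValues_lt (Nat.lt_succ_self _), sub_self]⟩
  refine ⟨i, Nat.one_le_iff_ne_zero.2 ?_, hi', not_le.1 hi⟩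
  rintro rfl
  exact hx.not_ge hi'

lemma cdij_eq (h1 : 1 ≤ j) (x : ℝ) :
    cdij C0 C i j x = (ordCost C0 C j - C0) /
      ((ordCost C0 C j - C0) * invSum C0 C (j - 1) + ∑ k ∈ Finset.Icc j i, groupCard C0 C k
        - x * invSum C0 C i) := by
  have hsum : ∑ k ∈ Finset.Icc 1 i, x * groupCard C0 C k / (ordCost C0 C k - C0)
      = x * invSum C0 C i := by
    rw [invSum, Finset.mul_sum]
    exact Finset.sum_congr rfl fun k _ => mul_div_assoc _ _ _
  rw [cdij, hsum]
  split_ifs with hj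
  · subst hj
    simp [invSum]
  · rfl

lemma cdij_succ_eq_div_sub (h0 : 0 < x) (hlo : ordCost C0 C (i + 1) - C0 ≤ x)
    (hhi : x ≤ ordCost C0 C i - C0) (hj : j + 1 ≤ i) :
    cdij C0 C i (j + 1) x = (ordCost C0 C (j + 1) - C0) /
      (minTotal (damage C0 C) x - minTotal (damage C0 C) (ordCost C0 C (j + 1) - C0)) := by
  classical
  have hd : x ≤ ordCost C0 C (j + 1) - C0 := hhi.trans (sub_le_sub_right (antitone_ordCost hj) C0)
  rw [cdij_eq (Nat.le_add_left 1 j), sum_groupCard_eq_card_sub_card (Nat.le_of_succ_le hj),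
    minTotal_eq_card_sub h0 hlo hhi, minTotal_eq_card_sub (h0.trans_le hd) le_rfl
      (sub_le_sub_right (antitone_ordCost j.le_succ) C0), Nat.add_sub_cancel]
  congr 1
  ring

variable [DecidableEq E]

lemma inPiece_succ_iff (h0 : 0 < x)
    (hx : x ∈ Set.Ico (ordCost C0 C (i + 1) - C0) (ordCost C0 C i - C0)) (h1 : 1 ≤ i) (hj : j < i) :
    InPiece C0 C i (j + 1) x ↔ minTotal (damage C0 C) x ∈
      Set.Ioc ((topGroups C0 C j).card : ℝ) ((topGroups C0 C (j + 1)).card) := by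
  have hiK : i ≤ numValues C0 C := le_numValues_of_lt_ordCost (sub_pos.1 (h0.trans hx.2))
  have hpos : 0 < invSum C0 C i := invSum_pos h1 hiK
  rw [InPiece, sum_groupCard_eq_card_sub_card hj.le, sum_groupCard_eq_card_sub_card hj,
    div_le_iff₀ hpos, lt_div_iff₀ hpos, minTotal_eq_card_sub h0 hx.1 hx.2.le,
    and_iff_right (Set.mem_Ico.1 hx), Set.mem_Ioc, and_comm, lt_sub_comm, sub_le_comm]

lemma exists_mem_Ioc_card_topGroups (h0 : 0 < x) (h1 : 1 ≤ i)
    (hx : x ∈ Set.Ico (ordCost C0 C (i + 1) - C0) (ordCost C0 C i - C0)) :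
    ∃ j < i, minTotal (damage C0 C) x ∈
      Set.Ioc ((topGroups C0 C j).card : ℝ) ((topGroups C0 C (j + 1)).card) := by
  have hiK : i ≤ numValues C0 C := le_numValues_of_lt_ordCost (sub_pos.1 (h0.trans hx.2))
  obtain ⟨e, he⟩ := exists_damage_eq h1 hiK
  have hpos : 0 < minTotal (damage C0 C) x :=
    (minTotal_nonneg (h0.trans hx.2).le).trans_lt
      (minTotal_lt h0.le hx.2 (hx.2.trans_eq he.symm))
  have hle : minTotal (damage C0 C) x ≤ (topGroups C0 C i).card := by
    rw [minTotal_eq_card_sub h0 hx.1 hx.2.le, invSum_eq_sum_topGroups]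
    refine sub_le_self _ (mul_nonneg h0.le (Finset.sum_nonneg fun e he => inv_nonneg.2 ?_))
    exact h0.le.trans ((isCut_topGroups hx.1 hx.2.le).1 e he)
  obtain ⟨j, hj, hj'⟩ := Nat.exists_not_and_succ_of_not_zero_of_exists
    (p := fun j => minTotal (damage C0 C) x ≤ (topGroups C0 C j).card)
    (by simpa [topGroups] using hpos) ⟨i, hle⟩
  refine ⟨j, not_le.1 fun hij => hj (hle.trans (monotone_card_topGroups hij)), not_le.1 hj, hj'⟩

lemma cdTilde_eq_cdij (h0 : 0 < x) (hi : 1 ≤ i)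
    (hx : x ∈ Set.Ico (ordCost C0 C (i + 1) - C0) (ordCost C0 C i - C0)) (hj : j < i)
    (hN : minTotal (damage C0 C) x ∈
      Set.Ioc ((topGroups C0 C j).card : ℝ) ((topGroups C0 C (j + 1)).card)) :
    cdTilde C0 C x = cdij C0 C i (j + 1) x := by
  have hlevel : Antitone fun k => ordCost C0 C k - C0 :=
    fun _ _ h => sub_le_sub_right (antitone_ordCost h) C0
  have hi_unique {i' j' : ℕ} (h : InPiece C0 C i' j' x) : i' = i := by_contra fun hne =>
    Set.disjoint_left.1 (hlevel.pairwise_disjoint_on_Ico_succ hne) h.1 hx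
  have hj_unique {j' : ℕ} (h1 : 1 ≤ j') (hj' : j' ≤ i) (h : InPiece C0 C i j' x) :
      j' = j + 1 := by
    obtain ⟨m, rfl⟩ := Nat.exists_eq_add_of_le' h1
    refine congrArg (· + 1) (by_contra fun hne => ?_)
    exact Set.disjoint_left.1 (monotone_card_topGroups.pairwise_disjoint_on_Ioc_succ hne)
      ((inPiece_succ_iff h0 hx hi hj').1 h) hN
  have hiK : i ≤ numValues C0 C := le_numValues_of_lt_ordCost (sub_pos.1 (h0.trans hx.2))
  rw [cdTilde, Finset.sum_eq_single_of_mem i (Finset.mem_Icc.2 ⟨hi, hiK⟩) fun i' _ hne =>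
      Finset.sum_eq_zero fun j' _ => if_neg fun h => hne (hi_unique h),
    Finset.sum_eq_single_of_mem (j + 1) (Finset.mem_Icc.2 ⟨Nat.le_add_left 1 j, hj⟩)
      fun j' hj' hne => if_neg fun h =>
        hne (hj_unique (Finset.mem_Icc.1 hj').1 (Finset.mem_Icc.1 hj').2 h),
    if_pos ((inPiece_succ_iff h0 hx hi hj).2 hN)]

omit [DecidableEq E] in
/-- With `d = C_(j+1) - C_0`, the formula reads `c * N x = d + c * N d` for the total efforts
`N`, and the range of `N x` says that `d` is the optimal level of an attack at the cost `c`. -/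
theorem isBreakEven_cdTilde (h0 : 0 < x) (hx1 : x < ordCost C0 C 1 - C0) :
    IsBreakEven (damage C0 C) x (cdTilde C0 C x) := by
  classical
  obtain ⟨i, hi, hx⟩ := exists_mem_Ico_ordCost h0.le hx1
  obtain ⟨j, hj, hN⟩ := exists_mem_Ioc_card_topGroups h0 hi hx
  rw [cdTilde_eq_cdij h0 hi hx hj hN, cdij_succ_eq_div_sub h0 hx.1 hx.2.le hj]
  have hxd : x < ordCost C0 C (j + 1) - C0 :=
    hx.2.trans_le (sub_le_sub_right (antitone_ordCost hj) C0)
  exact isBreakEven_of_isCut (isCut_topGroups_pred (Nat.le_add_left 1 j))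
    (isCut_topGroups_self (j + 1)) (h0.trans hxd) hN

end Threshold

section Regimes

variable {E : Type*} [Fintype E] {C0 : ℝ} {C : E → ℝ} {i j : ℕ} {ca cd : ℝ}

namespace RegimeOneZero

lemma pos (h : RegimeOneZero C0 C ca cd) : 0 < ca :=
  (sub_nonneg.2 (le_ordCost le_rfl)).trans_lt h.1

variable [DecidableEq E]

theorem isStackelbergSolution (h : RegimeOneZero C0 C ca cd) :
    IsStackelbergSolution C0 C ca cd 0 (fun τ => τ.1 none = 1) 0 := by
  have hρ : minEffort (damage C0 C) ca = 0 :=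
    funext fun e => minEffort_of_le ((damage_le_ordCost_one_sub C0 C e).trans h.1.le)
  have hN : cd * minTotal (damage C0 C) ca = 0 := by
    simp only [minTotal, hρ, Pi.zero_apply, Finset.sum_const_zero, mul_zero]
  rw [← hρ, ← hN]
  refine isStackelbergSolution_of_deterrence h.pos h.2 fun t ht => ?_
  rw [hN]
  have ht0 : 0 < t := h.pos.trans ht
  exact add_pos_of_pos_of_nonneg ht0 (mul_nonneg h.2.le (minTotal_nonneg ht0.le))

theorem speEfforts_eq (h : RegimeOneZero C0 C ca cd) : speEfforts C0 C ca cd = {0} :=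
  h.isStackelbergSolution.speEfforts_eq
    (effort_independentDefense (fun _ => le_rfl) fun _ => zero_le_one)
    (τ := stdSimplex.vertex none) (by simp)

theorem isSPE_iff (h : RegimeOneZero C0 C ca cd) (σd : DefStrategy E)
    (σa : DefStrategy E → AttStrategy E) :
    IsSPE C0 C ca cd σd σa ↔ (∀ e, effort σd e = 0) ∧ ∀ σ, (σa σ).1 none = 1 := by
  have hthreat (σ : DefStrategy E) (e : E) :
      (1 - effort σ e) * damage C0 C e ≤ ordCost C0 C 1 - C0 :=
    (mul_le_mul_of_nonneg_left (damage_le_ordCost_one_sub C0 C e)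
      (sub_nonneg.2 (effort_le_one σ e))).trans (mul_le_of_le_one_left
        (sub_nonneg.2 (le_ordCost le_rfl)) (sub_le_self _ (effort_nonneg σ e)))
  simp only [h.isStackelbergSolution.isSPE_iff, mem_BR_iff_none_eq_one h.1 (hthreat _),
    funext_iff, Pi.zero_apply]
  exact and_congr_right' (and_forall_ne (p := fun σ => (σa σ).1 none = 1) σd)

end RegimeOneZero

namespace RegimeOne

lemma pos (h : RegimeOne C0 C i ca cd) : 0 < ca :=
  (sub_nonneg.2 (le_ordCost (Nat.le_add_left 1 i))).trans_lt h.1.1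

variable [DecidableEq E]

theorem isStackelbergSolution (h : RegimeOne C0 C i ca cd) (hi : 1 ≤ i) :
    IsStackelbergSolution C0 C ca cd (minEffort (damage C0 C) ca) (fun τ => τ.1 none = 1)
      (cd * minTotal (damage C0 C) ca) := by
  have hca1 : ca < ordCost C0 C 1 - C0 :=
    h.1.2.trans_le (sub_le_sub_right (antitone_ordCost hi) C0)
  exact isStackelbergSolution_of_deterrence h.pos h.2.1 fun t ht =>
    (isBreakEven_cdTilde h.pos hca1).mul_minTotal_lt h.2.1.le h.2.2 (h.pos.trans ht)

theorem speEfforts_eq (h : RegimeOne C0 C i ca cd) (hi : 1 ≤ i) :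
    speEfforts C0 C ca cd = {minEffort (damage C0 C) ca} := by
  obtain ⟨σ, hσ⟩ := exists_effort_eq_minEffort (damage C0 C) h.pos.le
  exact (h.isStackelbergSolution hi).speEfforts_eq hσ (τ := stdSimplex.vertex none) (by simp)

theorem isSPE_iff (h : RegimeOne C0 C i ca cd) (hi : 1 ≤ i) (σd : DefStrategy E)
    (σa : DefStrategy E → AttStrategy E) :
    IsSPE C0 C ca cd σd σa ↔
      (∀ k ∈ Finset.Icc 1 i, ∀ e ∈ group C0 C k,
        effort σd e = (ordCost C0 C k - ca - C0) / (ordCost C0 C k - C0)) ∧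
      (∀ e, e ∉ topGroups C0 C i → effort σd e = 0) ∧
      (σa σd).1 none = 1 ∧ ∀ σ, σ ≠ σd → σa σ ∈ BR C0 C ca σ := by
  rw [(h.isStackelbergSolution hi).isSPE_iff, eq_minEffort_iff h.1.1.le h.1.2.le, and_assoc]

end RegimeOne

namespace RegimeTwo

lemma cd_pos (h : RegimeTwo C0 C j ca cd) (h1 : 1 ≤ j) (hj : j ≤ numValues C0 C) : 0 < cd :=
  (inv_pos.2 (invSum_pos h1 hj)).trans h.2.1

lemma one_lt_mul_invSum (h : RegimeTwo C0 C j ca cd) (h1 : 1 ≤ j) (hj : j ≤ numValues C0 C) :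
    1 < cd * invSum C0 C j :=
  (inv_lt_iff_one_lt_mul₀ (invSum_pos h1 hj)).1 h.2.1

lemma mul_invSum_pred_lt_one (h : RegimeTwo C0 C j ca cd) (h1 : 1 ≤ j)
    (hj : j ≤ numValues C0 C) : cd * invSum C0 C (j - 1) < 1 := by
  rcases h1.eq_or_lt with rfl | h2
  · simp [invSum]
  · rw [← lt_div_iff₀ (invSum_pos (Nat.le_sub_one_of_lt h2) ((Nat.sub_le j 1).trans hj)), one_div]
    exact h.2.2 h2

lemma add_mul_minTotal_lt (h : RegimeTwo C0 C j ca cd) (h1 : 1 ≤ j) (hj : j ≤ numValues C0 C)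
    (t : ℝ) (ht : 0 ≤ t) (hne : t ≠ ordCost C0 C j - C0) :
    ordCost C0 C j - C0 + cd * minTotal (damage C0 C) (ordCost C0 C j - C0)
      < t + cd * minTotal (damage C0 C) t := by
  classical
  have hA := h.mul_invSum_pred_lt_one h1 hj
  have hB := h.one_lt_mul_invSum h1 hj
  rw [invSum_eq_sum_topGroups] at hA hB
  exact SecurityGame.add_mul_minTotal_lt (isCut_topGroups_pred h1) (isCut_topGroups_self j)
    (sub_pos.2 (lt_ordCost h1 hj)) (h.cd_pos h1 hj).le hA hB ht hne

lemma exists_attStrategy_mul_eq (h : RegimeTwo C0 C j ca cd) (h1 : 1 ≤ j)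
    (hj : j ≤ numValues C0 C) :
    ∃ τ : AttStrategy E, AttacksWithin τ {e | ordCost C0 C j - C0 ≤ damage C0 C e} ∧
      (∀ e, τ.1 (some e) * damage C0 C e ≤ cd) ∧
      ∀ e, ordCost C0 C j - C0 < damage C0 C e → τ.1 (some e) * damage C0 C e = cd := by
  classical
  have hA := h.mul_invSum_pred_lt_one h1 hj
  have hB := h.one_lt_mul_invSum h1 hj
  rw [invSum_eq_sum_topGroups] at hA hB
  exact SecurityGame.exists_attStrategy_mul_eq (isCut_topGroups_pred h1) (isCut_topGroups_self j)
    (sub_pos.2 (lt_ordCost h1 hj)) (h.cd_pos h1 hj).le hA.le hB.le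

lemma add_mul_minTotal_le (h : RegimeTwo C0 C j ca cd) (h1 : 1 ≤ j) (hj : j ≤ numValues C0 C)
    (t : ℝ) (ht : 0 ≤ t) :
    ordCost C0 C j - C0 + cd * minTotal (damage C0 C) (ordCost C0 C j - C0)
      ≤ t + cd * minTotal (damage C0 C) t := by
  rcases eq_or_ne t (ordCost C0 C j - C0) with rfl | hne
  · rfl
  · exact (h.add_mul_minTotal_lt h1 hj t ht hne).le

lemma cdTildeInv_mem_and_cdTilde_eq (h : RegimeTwo C0 C j ca cd) (h1 : 1 ≤ j)
    (hj : j ≤ numValues C0 C) :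
    cdTildeInv C0 C cd ∈ Set.Ico 0 (ordCost C0 C 1 - C0) ∧
      cdTilde C0 C (cdTildeInv C0 C cd) = cd := by
  have hd : 0 < ordCost C0 C j - C0 := sub_pos.2 (lt_ordCost h1 hj)
  have hzero := h.add_mul_minTotal_lt h1 hj 0 le_rfl hd.ne
  rw [zero_add] at hzero
  obtain ⟨x, hx, hbreak⟩ :=
    exists_isBreakEven (h.cd_pos h1 hj) hd (h.add_mul_minTotal_le h1 hj) hzero
  have hx1 : x < ordCost C0 C 1 - C0 :=
    hx.2.trans_le (sub_le_sub_right (antitone_ordCost h1) C0)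
  have hex : ∃ x ∈ Set.Ico 0 (ordCost C0 C 1 - C0), cdTilde C0 C x = cd :=
    ⟨x, ⟨hx.1.le, hx1⟩, (isBreakEven_cdTilde hx.1 hx1).unique hbreak⟩
  exact ⟨Function.invFunOn_mem hex, Function.invFunOn_eq hex⟩

theorem add_mul_minTotal_lt_mul_minTotal (h : RegimeTwo C0 C j ca cd) (h1 : 1 ≤ j)
    (hj : j ≤ numValues C0 C) :
    ordCost C0 C j - C0 + cd * minTotal (damage C0 C) (ordCost C0 C j - C0)
      < cd * minTotal (damage C0 C) ca := by
  obtain ⟨hmem, heq⟩ := h.cdTildeInv_mem_and_cdTilde_eq h1 hj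
  have hbreak := isBreakEven_cdTilde (h.1.1.trans h.1.2) hmem.2
  rw [heq] at hbreak
  obtain ⟨t, ht, hvalue⟩ := hbreak.exists_eq
  obtain ⟨e, he⟩ := exists_damage_eq le_rfl (h1.trans hj)
  have hca : ca < damage C0 C e := h.1.2.trans (hmem.2.trans_eq he.symm)
  calc ordCost C0 C j - C0 + cd * minTotal (damage C0 C) (ordCost C0 C j - C0)
      ≤ t + cd * minTotal (damage C0 C) t :=
        h.add_mul_minTotal_le h1 hj t ht.le
    _ = cd * minTotal (damage C0 C) (cdTildeInv C0 C cd) := hvalue.symm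
    _ < cd * minTotal (damage C0 C) ca :=
        mul_lt_mul_of_pos_left (minTotal_lt h.1.1.le h.1.2 hca) (h.cd_pos h1 hj)

lemma lt_ordCost_sub (h : RegimeTwo C0 C j ca cd) (h1 : 1 ≤ j) (hj : j ≤ numValues C0 C) :
    ca < ordCost C0 C j - C0 := by
  by_contra! hle
  have hd : 0 < ordCost C0 C j - C0 := sub_pos.2 (lt_ordCost h1 hj)
  have hanti := minTotal_anti (δ := damage C0 C) hd.le hle
  linarith [h.add_mul_minTotal_lt_mul_minTotal h1 hj,
    mul_le_mul_of_nonneg_left hanti (h.cd_pos h1 hj).le]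

variable [DecidableEq E]

theorem isStackelbergSolution (h : RegimeTwo C0 C j ca cd) (h1 : 1 ≤ j)
    (hj : j ≤ numValues C0 C) :
    IsStackelbergSolution C0 C ca cd (minEffort (damage C0 C) (ordCost C0 C j - C0))
      (fun τ => AttacksWithin τ {e | ordCost C0 C j - C0 ≤ damage C0 C e})
      (ordCost C0 C j - C0 + cd * minTotal (damage C0 C) (ordCost C0 C j - C0)) :=
  isStackelbergSolution_of_tolerance h.1.1 (h.cd_pos h1 hj) (h.lt_ordCost_sub h1 hj)
    (exists_damage_eq h1 hj) (h.add_mul_minTotal_lt_mul_minTotal h1 hj)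
    (h.add_mul_minTotal_lt h1 hj)

theorem speEfforts_eq (h : RegimeTwo C0 C j ca cd) (h1 : 1 ≤ j) (hj : j ≤ numValues C0 C) :
    speEfforts C0 C ca cd = {minEffort (damage C0 C) (ordCost C0 C j - C0)} := by
  obtain ⟨σ, hσ⟩ := exists_effort_eq_minEffort (damage C0 C) (sub_pos.2 (lt_ordCost h1 hj)).le
  obtain ⟨τ, hτ, -⟩ := h.exists_attStrategy_mul_eq h1 hj
  exact (h.isStackelbergSolution h1 hj).speEfforts_eq hσ hτ

theorem neEfforts_eq (h : RegimeTwo C0 C j ca cd) (h1 : 1 ≤ j) (hj : j ≤ numValues C0 C) :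
    neEfforts C0 C ca cd = {minEffort (damage C0 C) (ordCost C0 C j - C0)} := by
  obtain ⟨τ, hτ, hle, heq⟩ := h.exists_attStrategy_mul_eq h1 hj
  exact (h.isStackelbergSolution h1 hj).neEfforts_eq (sub_pos.2 (lt_ordCost h1 hj))
    (h.lt_ordCost_sub h1 hj) (exists_damage_eq h1 hj) hτ hle heq

theorem isSPE_iff (h : RegimeTwo C0 C j ca cd) (h1 : 1 ≤ j) (hj : j ≤ numValues C0 C)
    (σd : DefStrategy E) (σa : DefStrategy E → AttStrategy E) :
    IsSPE C0 C ca cd σd σa ↔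
      (∀ k ∈ Finset.Icc 1 (j - 1), ∀ e ∈ group C0 C k,
        effort σd e = (ordCost C0 C k - ordCost C0 C j) / (ordCost C0 C k - C0)) ∧
      (∀ e, e ∉ topGroups C0 C (j - 1) → effort σd e = 0) ∧
      AttacksWithin (σa σd) (topGroups C0 C j) ∧ ∀ σ, σ ≠ σd → σa σ ∈ BR C0 C ca σ := by
  rw [(h.isStackelbergSolution h1 hj).isSPE_iff, topGroups_eq_filter h1 hj,
    eq_minEffort_iff (i := j - 1) (by rw [Nat.sub_add_cancel h1])
      (sub_le_sub_right (antitone_ordCost (Nat.sub_le j 1)) C0), and_assoc]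
  simp only [sub_sub, sub_add_cancel]

end RegimeTwo

end Regimes

end SecurityGame

open SecurityGame in
theorem theorem2 {E : Type*} [Fintype E] [DecidableEq E] (C0 : ℝ) (C : E → ℝ) (ca cd : ℝ)
    (hca : 0 < ca) (hcd : 0 < cd) (hE : (Ebar C0 C).Nonempty) :
    -- regime `i = 0` of the first type
    (RegimeOneZero C0 C ca cd →
      (∃! ρ : E → ℝ, ρ ∈ speEfforts C0 C ca cd) ∧
      ∀ (σd : DefStrategy E) (σa : DefStrategy E → AttStrategy E),
        IsSPE C0 C ca cd σd σa ↔
          (∀ e, effort σd e = 0) ∧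
          (∀ σd' : DefStrategy E, (σa σd').1 none = 1)) ∧
    -- regimes `i = 1, …, K` of the first type
    (∀ i ∈ Finset.Icc 1 (numValues C0 C), RegimeOne C0 C i ca cd →
      (∃! ρ : E → ℝ, ρ ∈ speEfforts C0 C ca cd) ∧
      ∀ (σd : DefStrategy E) (σa : DefStrategy E → AttStrategy E),
        IsSPE C0 C ca cd σd σa ↔
          (∀ k ∈ Finset.Icc 1 i, ∀ e ∈ group C0 C k,
            effort σd e = (ordCost C0 C k - ca - C0) / (ordCost C0 C k - C0)) ∧
          (∀ e, e ∉ topGroups C0 C i → effort σd e = 0) ∧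
          (σa σd).1 none = 1 ∧
          (∀ σd' : DefStrategy E, σd' ≠ σd → σa σd' ∈ BR C0 C ca σd')) ∧
    -- regime `j = 1` of the second type
    (RegimeTwo C0 C 1 ca cd →
      (∃! ρ : E → ℝ, ρ ∈ speEfforts C0 C ca cd) ∧
      speEfforts C0 C ca cd = neEfforts C0 C ca cd ∧
      ∀ (σd : DefStrategy E) (σa : DefStrategy E → AttStrategy E),
        IsSPE C0 C ca cd σd σa ↔
          (∀ e, effort σd e = 0) ∧
          AttacksWithin (σa σd) (group C0 C 1) ∧
          (∀ σd' : DefStrategy E, σd' ≠ σd → σa σd' ∈ BR C0 C ca σd')) ∧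
    -- regimes `j = 2, …, K` of the second type
    (∀ j ∈ Finset.Icc 2 (numValues C0 C), RegimeTwo C0 C j ca cd →
      (∃! ρ : E → ℝ, ρ ∈ speEfforts C0 C ca cd) ∧
      speEfforts C0 C ca cd = neEfforts C0 C ca cd ∧
      ∀ (σd : DefStrategy E) (σa : DefStrategy E → AttStrategy E),
        IsSPE C0 C ca cd σd σa ↔
          (∀ k ∈ Finset.Icc 1 (j - 1), ∀ e ∈ group C0 C k,
            effort σd e = (ordCost C0 C k - ordCost C0 C j) / (ordCost C0 C k - C0)) ∧
          (∀ e, e ∉ topGroups C0 C (j - 1) → effort σd e = 0) ∧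
          AttacksWithin (σa σd) (topGroups C0 C j) ∧
          (∀ σd' : DefStrategy E, σd' ≠ σd → σa σd' ∈ BR C0 C ca σd')) := by
  have hK : 1 ≤ numValues C0 C := Finset.card_pos.2 (hE.image C)
  refine ⟨fun h => ⟨?_, h.isSPE_iff⟩, fun i hi h => ?_, fun h => ?_, fun j hj h => ?_⟩
  · simp only [h.speEfforts_eq, Set.mem_singleton_iff, existsUnique_eq]
  · have h1 : 1 ≤ i := (Finset.mem_Icc.1 hi).1
    refine ⟨?_, h.isSPE_iff h1⟩
    simp only [h.speEfforts_eq h1, Set.mem_singleton_iff, existsUnique_eq]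
  · refine ⟨?_, (h.speEfforts_eq le_rfl hK).trans (h.neEfforts_eq le_rfl hK).symm,
      fun σd σa => (h.isSPE_iff le_rfl hK σd σa).trans ?_⟩
    · simp only [h.speEfforts_eq le_rfl hK, Set.mem_singleton_iff, existsUnique_eq]
    · simp [topGroups_one, topGroups_zero]
  · obtain ⟨h2, hjK⟩ := Finset.mem_Icc.1 hj
    have h1 : 1 ≤ j := Nat.one_le_of_lt h2
    refine ⟨?_, (h.speEfforts_eq h1 hjK).trans (h.neEfforts_eq h1 hjK).symm, h.isSPE_iff h1 hjK⟩
    simp only [h.speEfforts_eq h1 hjK, Set.mem_singleton_iff, existsUnique_eq]
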